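/- Let $X$ be a complex Banach space, let $d\ge 1$, $p\in(1,2]$ and $\frac1p+\frac1q=1$. For $f\in L^1(\mathbb R^d;X)$ put $\mathscr F_{\mathbb R^d}f(\xi)=\int_{\mathbb R^d}e^{-2\pi i x\cdot\xi}f(x)\,dx$ $(\xi\in\mathbb R^d)$, and for $f\in L^1(\mathbb T^d;X)$ put $\mathscr F_{\mathbb T^d}f(k)=\int_{\mathbb T^d}e^{-2\pi i k\cdot t}f(t)\,dt$ $(k\in\mathbb Z^d)$, where $\mathbb T=\mathbb R/\mathbb Z$ carries its normalised Haar measure. Then $\mathscr F_{\mathbb R^d}$ (initially defined on $L^1\cap L^p$) extends to a bounded operator from $L^p(\mathbb R^d;X)$ into $L^q(\mathbb R^d;X)$ if and only if $\mathscr F_{\mathbb T^d}$ extends to a bounded operator from $L^p(\mathbb T^d;X)$ into $\ell^q(\mathbb Z^d;X)$. If these equivalent properties hold (that is, if $X$ has Fourier type $p$), then the norms $\varphi_{p,X}(\mathbb R^d)$ and $\varphi_{p,X}(\mathbb T^d)$ of these (unique) extensions satisfy $$\varphi_{p,X}(\mathbb R^d)\le\varphi_{p,X}(\mathbb T^d)\le\frac{\pi^d}{\bigl(2(2^q-1)\zeta(q)\bigr)^{d/q}}\,\varphi_{p,X}(\mathbb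 R^d),$$ where $\zeta$ is the Riemann zeta function, and in particular $$\varphi_{p,X}(\mathbb T^d)\le\bigl(\tfrac{\pi}{2}\bigr)^d\,\varphi_{p,X}(\mathbb R^d).$$ -/

import Mathlib

open MeasureTheory Real
open scoped ENNReal FourierTransform

/-- `T` is a bounded operator from `L^p(ℝ^d; X)` into `L^q(ℝ^d; X)` that extends the Fourier
transform `f ↦ (ξ ↦ ∫ e^{-2πi x·ξ} f(x) dx)`, which is given by the integral on
`L^1(ℝ^d; X) ∩ L^p(ℝ^d; X)`. By density of this subspace there is at most one such `T`. -/
def IsFourierExtensionEuclidean (d : ℕ) {X : Type*} [NormedAddCommGroup X] [NormedSpace ℂ X]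
    {p q : ℝ≥0∞} [Fact (1 ≤ p)] [Fact (1 ≤ q)]
    (T : Lp X p (volume : Measure (EuclideanSpace ℝ (Fin d))) →L[ℂ]
      Lp X q (volume : Measure (EuclideanSpace ℝ (Fin d)))) : Prop :=
  ∀ f : Lp X p (volume : Measure (EuclideanSpace ℝ (Fin d))),
    Integrable (f : EuclideanSpace ℝ (Fin d) → X) volume →
      (T f : EuclideanSpace ℝ (Fin d) → X) =ᵐ[volume]
        𝓕 (f : EuclideanSpace ℝ (Fin d) → X)

/-- The normalised Haar measure `dt` on the torus `𝕋^d = (ℝ/ℤ)^d`. -/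
noncomputable abbrev torusMeasure (d : ℕ) : Measure (UnitAddTorus (Fin d)) :=
  Measure.pi fun _ => AddCircle.haarAddCircle

/-- `S` is a bounded operator from `L^p(𝕋^d; X)` into `ℓ^q(ℤ^d; X)` that extends the Fourier
transform `f ↦ (k ↦ ∫ e^{-2πi k·t} f(t) dt)`. The torus carries its normalised Haar measure, so
(for `p ≥ 1`) `L^p(𝕋^d; X) ⊆ L^1(𝕋^d; X)` and the transform is given by the integral for every `f`
in `L^p(𝕋^d; X)`. -/
def IsFourierExtensionTorus (d : ℕ) {X : Type*} [NormedAddCommGroup X] [NormedSpace ℂ X]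
    {p q : ℝ≥0∞} [Fact (1 ≤ p)] [Fact (1 ≤ q)]
    (S : Lp X p (torusMeasure d) →L[ℂ]
      lp (fun _ : Fin d → ℤ => X) q) : Prop :=
  ∀ (f : Lp X p (torusMeasure d)) (k : Fin d → ℤ),
    S f k = ∫ t, UnitAddTorus.mFourier (-k) t • (f : UnitAddTorus (Fin d) → X) t ∂torusMeasure d

/-!
Both directions are transference arguments between `ℝ^d` and `𝕋^d`, along the tiling of `ℝ^d` by the
translates `k + (0, 1]^d` of the unit cell.

**From `𝕋^d` to `ℝ^d`.** A function `h` supported in a unit cell is also a function on the torus, and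
its Fourier coefficients are the values of `𝓕 h` on `ℤ^d`. Applying the bound on the torus to the
modulations `x ↦ e^{-2πi x·θ} h(x)` bounds the `ℓ^q` norm of `𝓕 h` on `θ + ℤ^d`, and integrating
over `θ` in the unit cell gives `‖𝓕 h‖_q ≤ ‖S‖ ‖h‖_p` (`eLpNorm_fourier_le_of_unitCell`). Both sides
scale in the same way under dilations, so this holds for bounded supports
(`eLpNorm_fourier_le_of_cube`), and by Fatou's lemma on `L^1 ∩ L^p` (`eLpNorm_fourier_le`), which is
dense in `L^p`.

**From `ℝ^d` to `𝕋^d`.** Let `s` be the Fourier transform of the indicator function of `[0, 1]`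
(`cellKernel`), so that `|s(x)| = |sin πx / πx|`. For large `N`, the window `h` on `(-N, N]` is
`conj s |s|^{q-2} / w`, where `w(x) = ∑ |s(x + n)|^q` over the `n` with `x + n ∈ (-N, N]`. Then
`∑ h(x + n) s(x + n) = 1` and `∑ |h(x + n)|^p = w(x)^{1-p}`. Take tensor products of `h` and of `s` in
the `d` coordinates, and let `G` be the product of the window with the periodic function given by
`f`. The first identity shows that the Fourier coefficient of `f` at `k` is the Fourier transform at
`k` of `G` times the kernel, that is, the average of `𝓕 G` over `k + (0, 1]^d`. By Jensen's
inequality the `ℓ^q` norm of the coefficients is at most `‖𝓕 G‖_q ≤ ‖T‖ ‖G‖_p`, and the second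
identity bounds `‖G‖_p` by `(min w)^{-d/q} ‖f‖_p`. Nothing is dualised, so the argument takes place
in `X` itself.

**The constant.** It remains to see that `w` is smallest at `1/2` (`kernelPowerSum_half_le`); there
it tends to `2 (2^q - 1) ζ(q) / π^q` as `N → ∞`. By Parseval, `∑ |s(t + n)|² = 1` for all `t`. Pair
the points of `t + ℤ` as `t + m` and `t - (m + 1)`. For `m ≥ 1` the pair contributes at most what it
does at `t = 1/2` (`norm_cellKernel_sq_pair_le`), so as `t` moves away from `1/2` mass moves to the
pair `m = 0`, where the values at `t = 1/2` are largest. Convexity of `x ↦ x^{q/2}`, by way of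
tangent lines at the values for `t = 1/2`, turns this into the inequality for `q`-th powers.
-/

/-! ### Unit cells of `ℝ^d` and the torus -/

/-- The half-open unit cell `∏ i, (a i, a i + 1]` in `ℝ^d`. -/
def unitCell {d : ℕ} (a : Fin d → ℝ) : Set (EuclideanSpace ℝ (Fin d)) :=
  {x | ∀ i, x i ∈ Set.Ioc (a i) (a i + 1)}

/-- The point of `ℝ^d` with the integer coordinates `n`. -/
noncomputable def latticePoint {d : ℕ} (n : Fin d → ℤ) : EuclideanSpace ℝ (Fin d) :=
  WithLp.toLp 2 fun i => (n i : ℝ)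

/-- The covering map `ℝ^d → 𝕋^d`. -/
noncomputable def torusMk {d : ℕ} (x : EuclideanSpace ℝ (Fin d)) : UnitAddTorus (Fin d) :=
  fun i => (x i : UnitAddCircle)

/-- The section of the covering map `ℝ^d → 𝕋^d` with values in the unit cell at `a`. -/
noncomputable def torusSection {d : ℕ} (a : Fin d → ℝ) (t : UnitAddTorus (Fin d)) :
    EuclideanSpace ℝ (Fin d) :=
  WithLp.toLp 2 fun i => (AddCircle.equivIoc 1 (a i) (t i) : ℝ)

@[simp]
lemma latticePoint_apply {d : ℕ} (n : Fin d → ℤ) (i : Fin d) : latticePoint n i = n i := rfl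

lemma unitCell_eq_preimage {d : ℕ} (a : Fin d → ℝ) :
    unitCell a = WithLp.ofLp ⁻¹' (Set.univ.pi fun i => Set.Ioc (a i) (a i + 1)) := by
  ext x; simp [unitCell]

lemma measurableSet_unitCell {d : ℕ} (a : Fin d → ℝ) : MeasurableSet (unitCell a) := by
  rw [unitCell_eq_preimage]
  exact (WithLp.measurable_ofLp 2 _) (MeasurableSet.univ_pi fun _ => measurableSet_Ioc)

lemma measurePreserving_ofLp_unitCell {d : ℕ} (a : Fin d → ℝ) :
    MeasurePreserving WithLp.ofLp (volume.restrict (unitCell a))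
      (Measure.pi fun i => volume.restrict (Set.Ioc (a i) (a i + 1))) := by
  rw [← Measure.restrict_pi_pi, unitCell_eq_preimage]
  exact (PiLp.volume_preserving_ofLp (Fin d)).restrict_preimage
    (MeasurableSet.univ_pi fun _ => measurableSet_Ioc)

lemma measurable_torusMk {d : ℕ} : Measurable (torusMk (d := d)) := by
  unfold torusMk
  refine measurable_pi_lambda _ fun i => AddCircle.measurable_mk'.comp ?_
  fun_prop

lemma measurePreserving_torusMk {d : ℕ} (a : Fin d → ℝ) :
    MeasurePreserving torusMk (volume.restrict (unitCell a)) (torusMeasure d) := by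
  have h := measurePreserving_pi (fun i => volume.restrict (Set.Ioc (a i) (a i + 1)))
    (fun _ => (AddCircle.haarAddCircle : Measure UnitAddCircle)) (fun i => by
      have := AddCircle.measurePreserving_mk 1 (a i)
      rwa [AddCircle.volume_eq_smul_haarAddCircle, ENNReal.ofReal_one, one_smul] at this)
  exact h.comp (measurePreserving_ofLp_unitCell a)

instance isProbabilityMeasure_unitCell {d : ℕ} (a : Fin d → ℝ) :
    IsProbabilityMeasure (volume.restrict (unitCell a)) := by
  refine ⟨?_⟩
  have h := (measurePreserving_torusMk a).measure_preimage MeasurableSet.univ.nullMeasurableSet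
  rw [Set.preimage_univ] at h
  rw [h, measure_univ]

@[simp]
lemma torusMk_torusSection {d : ℕ} (a : Fin d → ℝ) (t : UnitAddTorus (Fin d)) :
    torusMk (torusSection a t) = t := by
  funext i
  exact (AddCircle.equivIoc 1 (a i)).symm_apply_apply (t i)

lemma torusSection_torusMk {d : ℕ} {a : Fin d → ℝ} {x : EuclideanSpace ℝ (Fin d)}
    (hx : x ∈ unitCell a) : torusSection a (torusMk x) = x := by
  ext i
  exact congrArg Subtype.val ((AddCircle.equivIoc 1 (a i)).apply_symm_apply ⟨x i, hx i⟩)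

lemma measurable_torusSection {d : ℕ} (a : Fin d → ℝ) : Measurable (torusSection a) := by
  refine (WithLp.measurable_toLp 2 _).comp (measurable_pi_lambda _ fun i => ?_)
  exact measurable_subtype_coe.comp
    ((AddCircle.measurableEquivIoc 1 (a i)).measurable.comp (measurable_pi_apply i))

lemma measurePreserving_torusSection {d : ℕ} (a : Fin d → ℝ) :
    MeasurePreserving (torusSection a) (torusMeasure d) (volume.restrict (unitCell a)) := by
  refine ⟨measurable_torusSection a, ?_⟩
  rw [← (measurePreserving_torusMk a).map_eq,
    Measure.map_map (measurable_torusSection a) measurable_torusMk]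
  conv_rhs => rw [← Measure.map_id (μ := volume.restrict (unitCell a))]
  refine Measure.map_congr ?_
  filter_upwards [ae_restrict_mem (measurableSet_unitCell a)] with x hx
  exact torusSection_torusMk hx

lemma torusMk_add_latticePoint {d : ℕ} (x : EuclideanSpace ℝ (Fin d)) (n : Fin d → ℤ) :
    torusMk (x + latticePoint n) = torusMk x := by
  funext i
  simp [torusMk]

lemma iUnion_unitCell_intCast (d : ℕ) :
    (⋃ n : Fin d → ℤ, unitCell fun i => (n i : ℝ)) = Set.univ := by
  refine Set.eq_univ_of_forall fun x => Set.mem_iUnion.2 ⟨fun i => ⌈x i⌉ - 1, fun i => ?_⟩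
  have h₁ := Int.le_ceil (x i)
  have h₂ := Int.ceil_lt_add_one (x i)
  constructor <;> push_cast <;> linarith

lemma pairwise_disjoint_unitCell_intCast (d : ℕ) :
    Pairwise (Function.onFun Disjoint fun n : Fin d → ℤ => unitCell fun i => (n i : ℝ)) := by
  intro m n hmn
  refine Set.disjoint_left.2 fun x hm hn => hmn (funext fun i => ?_)
  have h₁ := hm i
  have h₂ := hn i
  simp only [Set.mem_Ioc] at h₁ h₂
  have h₃ : (m i : ℝ) < n i + 1 := by linarith
  have h₄ : (n i : ℝ) < m i + 1 := by linarith
  norm_cast at h₃ h₄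
  omega

lemma preimage_add_latticePoint_unitCell {d : ℕ} (n : Fin d → ℤ) :
    (fun x => x + latticePoint n) ⁻¹' (unitCell fun i => (n i : ℝ)) =
      unitCell (0 : Fin d → ℝ) := by
  ext x
  simp only [unitCell, Set.mem_preimage, Set.mem_ofPred_eq, PiLp.add_apply, latticePoint_apply,
    Set.mem_Ioc, Pi.zero_apply]
  refine forall_congr' fun i => ⟨fun h => ?_, fun h => ?_⟩ <;> constructor <;> linarith [h.1, h.2]

lemma lintegral_eq_tsum_unitCell {d : ℕ} (g : EuclideanSpace ℝ (Fin d) → ℝ≥0∞) :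
    ∫⁻ x, g x = ∑' n : Fin d → ℤ, ∫⁻ x in unitCell 0, g (x + latticePoint n) := by
  rw [← setLIntegral_univ, ← iUnion_unitCell_intCast d,
    lintegral_iUnion (fun n => measurableSet_unitCell _) (pairwise_disjoint_unitCell_intCast d)]
  refine tsum_congr fun n => ?_
  rw [← preimage_add_latticePoint_unitCell n]
  exact ((measurePreserving_add_right volume (latticePoint n)).setLIntegral_comp_preimage_emb
    (measurableEmbedding_addRight _) g _).symm

lemma hasSum_integral_unitCell {d : ℕ} {X : Type*} [NormedAddCommGroup X] [NormedSpace ℝ X]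
    {g : EuclideanSpace ℝ (Fin d) → X} (hg : Integrable g) :
    HasSum (fun n : Fin d → ℤ => ∫ x in unitCell 0, g (x + latticePoint n)) (∫ x, g x) := by
  rw [← setIntegral_univ, ← iUnion_unitCell_intCast d]
  convert hasSum_integral_iUnion
    (fun n : Fin d → ℤ => measurableSet_unitCell fun i => (n i : ℝ))
    (pairwise_disjoint_unitCell_intCast d) hg.integrableOn using 2 with n
  rw [← preimage_add_latticePoint_unitCell n]
  exact (measurePreserving_add_right volume (latticePoint n)).setIntegral_preimage_emb
    (measurableEmbedding_addRight _) g _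

/-! ### The Fourier transform of the unit interval -/

/-- The Fourier transform `x ↦ ∫₀¹ e^{-2πiux} du` of the indicator function of `[0, 1]`. -/
noncomputable def cellKernel (x : ℝ) : ℂ :=
  ∫ u in (0 : ℝ)..1, Complex.exp ((-2 * π * (u * x) : ℝ) * Complex.I)

lemma continuous_cellKernel : Continuous cellKernel := by
  unfold cellKernel
  exact intervalIntegral.continuous_parametric_intervalIntegral_of_continuous' (by fun_prop) 0 1

lemma norm_cellKernel_le_one (x : ℝ) : ‖cellKernel x‖ ≤ 1 := by
  have := intervalIntegral.norm_integral_le_of_norm_le_const (a := 0) (b := 1) (C := 1)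
    (f := fun u : ℝ => Complex.exp ((-2 * π * (u * x) : ℝ) * Complex.I))
    (fun u _ => (Complex.norm_exp_ofReal_mul_I _).le)
  simpa [cellKernel] using this

lemma norm_cellKernel_sq {x : ℝ} (hx : x ≠ 0) :
    ‖cellKernel x‖ ^ 2 = sin (π * x) ^ 2 / (π * x) ^ 2 := by
  have hc : ((-2 * π * x : ℝ) : ℂ) * Complex.I ≠ 0 := by
    simp [hx, pi_ne_zero]
  have h : cellKernel x = (Complex.exp ((-2 * π * x : ℝ) * Complex.I) - 1) /
      ((-2 * π * x : ℝ) * Complex.I) := by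
    have := integral_exp_mul_complex (a := 0) (b := 1) hc
    rw [Complex.ofReal_one, Complex.ofReal_zero, mul_one, mul_zero, Complex.exp_zero] at this
    rw [← this, cellKernel]
    refine intervalIntegral.integral_congr fun u _ => ?_
    congr 1
    push_cast
    ring
  have h2 : (-2 * π * x) = 2 * (-(π * x)) := by ring
  rw [h, norm_div, norm_mul, Complex.norm_I, mul_one, div_pow, Complex.norm_real, norm_eq_abs,
    sq_abs, ← Complex.normSq_eq_norm_sq, Complex.exp_mul_I, ← Complex.ofReal_cos,
    ← Complex.ofReal_sin, Complex.normSq_apply]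
  simp only [Complex.sub_re, Complex.add_re, Complex.ofReal_re, Complex.mul_re, Complex.I_re,
    Complex.I_im, Complex.ofReal_im, Complex.one_re, Complex.sub_im, Complex.add_im,
    Complex.mul_im, Complex.one_im]
  rw [h2, cos_two_mul, sin_two_mul, cos_neg, sin_neg]
  have h3 := sin_sq_add_cos_sq (π * x)
  have h4 : π * x ≠ 0 := mul_ne_zero pi_ne_zero hx
  rw [div_eq_div_iff (pow_ne_zero 2 (by simpa using h4)) (by positivity)]
  have h5 : cos (π * x) ^ 2 = 1 - sin (π * x) ^ 2 := by linarith
  ring_nf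
  ring_nf at h5
  rw [show cos (π * x) ^ 4 = (cos (π * x) ^ 2) ^ 2 by ring, h5]
  ring

/-- The number `cellKernel (t + n)` is the `n`-th Fourier coefficient of `u ↦ e^{-2πitu}` on
`(0, 1]`, so this is Parseval's identity. -/
lemma hasSum_norm_cellKernel_sq (t : ℝ) :
    HasSum (fun n : ℤ => ‖cellKernel (t + n)‖ ^ 2) 1 := by
  have hc : Continuous fun u : ℝ => Complex.exp ((-2 * π * (u * t) : ℝ) * Complex.I) := by
    fun_prop
  have hL2 : MemLp (fun u : ℝ => Complex.exp ((-2 * π * (u * t) : ℝ) * Complex.I)) 2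
      (volume.restrict (Set.Ioc (0 : ℝ) 1)) :=
    MemLp.of_bound hc.aestronglyMeasurable 1
      (Filter.Eventually.of_forall fun u => (Complex.norm_exp_ofReal_mul_I _).le)
  convert hasSum_sq_fourierCoeffOn zero_lt_one hL2 using 1
  · funext n
    rw [fourierCoeffOn_eq_integral, cellKernel]
    simp only [sub_zero, div_one, one_smul]
    congr 2
    refine intervalIntegral.integral_congr fun u _ => ?_
    simp only [fourier_coe_apply, smul_eq_mul]
    rw [← Complex.exp_add]
    congr 1
    push_cast
    ring
  · simp only [Complex.norm_exp_ofReal_mul_I]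
    simp

/-! ### Power sums of the kernel along `t + ℤ` -/

/-- The sum of `‖cellKernel x‖ ^ q` over the `2 N` points `x ∈ t + ℤ` with `-N ≤ x - t < N`. -/
noncomputable def kernelPowerSum (q : ℝ) (N : ℕ) (t : ℝ) : ℝ :=
  ∑ n ∈ Finset.Ico (-(N : ℤ)) N, ‖cellKernel (t + n)‖ ^ q

lemma sum_Ico_neg_eq_sum_range {M : Type*} [AddCommMonoid M] (F : ℤ → M) (N : ℕ) :
    ∑ n ∈ Finset.Ico (-(N : ℤ)) N, F n = ∑ m ∈ Finset.range N, (F m + F (-(m + 1 : ℤ))) := by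
  induction N with
  | zero => simp
  | succ N ih =>
    have h1 : Finset.Ico (-((N + 1 : ℕ) : ℤ)) ((N + 1 : ℕ) : ℤ) =
        insert (N : ℤ) (insert (-(N + 1 : ℤ)) (Finset.Ico (-(N : ℤ)) N)) := by
      ext x; simp only [Finset.mem_Ico, Finset.mem_insert]; push_cast; omega
    rw [h1, Finset.sum_insert (by simp; omega), Finset.sum_insert (by simp),
      Finset.sum_range_succ, ih]
    abel

lemma norm_cellKernel_sq_half (m : ℕ) :
    ‖cellKernel (1 / 2 + m)‖ ^ 2 = (π * (m + 1 / 2))⁻¹ ^ 2 ∧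
      ‖cellKernel (1 / 2 - (m + 1))‖ ^ 2 = (π * (m + 1 / 2))⁻¹ ^ 2 := by
  have hm : (0 : ℝ) ≤ m := m.cast_nonneg
  have hs : sin (π * (1 / 2 + m)) ^ 2 = 1 := by
    rw [show π * (1 / 2 + m) = π / 2 + m * π by ring, sin_add_nat_mul_pi, sin_pi_div_two, mul_one,
      ← pow_mul, mul_comm, pow_mul]
    norm_num
  constructor
  · rw [norm_cellKernel_sq (by positivity), hs, add_comm (1 / 2 : ℝ), one_div, inv_pow]
  · rw [norm_cellKernel_sq (by linarith), show π * (1 / 2 - (m + 1)) = -(π * (1 / 2 + m)) by ring,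
      sin_neg, neg_sq, neg_sq, hs, add_comm (1 / 2 : ℝ), one_div, inv_pow]

/-- Apart from the two points of `t + ℤ` nearest to `0`, each pair of points of `t + ℤ` at the same
rank contributes most to Parseval's identity at `t = 1 / 2`. -/
lemma norm_cellKernel_sq_pair_le {t : ℝ} (ht : t ∈ Set.Icc (0 : ℝ) 1) {m : ℕ} (hm : 1 ≤ m) :
    ‖cellKernel (t + m)‖ ^ 2 + ‖cellKernel (t - (m + 1))‖ ^ 2 ≤ 2 * (π * (m + 1 / 2))⁻¹ ^ 2 := by
  have hm' : (1 : ℝ) ≤ m := by exact_mod_cast hm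
  obtain ⟨ht0, ht1⟩ := ht
  obtain ⟨s, rfl⟩ : ∃ s, t = s + 1 / 2 := ⟨t - 1 / 2, by ring⟩
  obtain ⟨j, hj⟩ : ∃ j : ℝ, j = m + 1 / 2 := ⟨_, rfl⟩
  have hj2 : 3 / 2 ≤ j := by linarith
  have h₁ : sin (π * (s + j)) ^ 2 = cos (π * s) ^ 2 := by
    rw [show π * (s + j) = π * s + π / 2 + m * π by rw [hj]; ring, sin_add_nat_mul_pi,
      sin_add_pi_div_two, mul_pow, ← pow_mul, mul_comm m, pow_mul]
    norm_num
  have h₂ : sin (π * (s - j)) ^ 2 = cos (π * s) ^ 2 := by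
    rw [show π * (s - j) = π * s - π / 2 - m * π by rw [hj]; ring, sin_sub_nat_mul_pi,
      sin_sub_pi_div_two, mul_pow, ← pow_mul, mul_comm m, pow_mul]
    norm_num
  rw [show s + 1 / 2 + m = s + j by rw [hj]; ring,
    show s + 1 / 2 - (m + 1) = s - j by rw [hj]; ring, ← hj,
    norm_cellKernel_sq (by linarith), norm_cellKernel_sq (by linarith), h₁, h₂]
  have hS : s ^ 2 ≤ 1 / 4 := by nlinarith
  have hcos0 : 0 ≤ cos (π * s) := by
    apply cos_nonneg_of_neg_pi_div_two_le_of_le <;> nlinarith [pi_pos]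
  have hcos1 : cos (π * s) ≤ 1 - 2 * s ^ 2 := by
    have := cos_le_one_sub_mul_cos_sq (x := π * s) (by
      rw [abs_mul, abs_of_pos pi_pos]
      have : |s| ≤ 1 := abs_le.2 ⟨by linarith, by linarith⟩
      nlinarith [pi_pos])
    have h : 2 / π ^ 2 * (π * s) ^ 2 = 2 * s ^ 2 := by
      field_simp
    linarith
  have hcos2 : cos (π * s) ^ 2 ≤ 1 - 2 * s ^ 2 := by nlinarith [sq_nonneg s]
  have hp : 0 < s + j := by linarith
  have hn : 0 < j - s := by linarith
  have hJ : 9 / 4 ≤ j ^ 2 := by nlinarith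
  have key : cos (π * s) ^ 2 * (j ^ 2 * (j ^ 2 + s ^ 2)) ≤ (j ^ 2 - s ^ 2) ^ 2 := by
    calc cos (π * s) ^ 2 * (j ^ 2 * (j ^ 2 + s ^ 2))
        ≤ (1 - 2 * s ^ 2) * (j ^ 2 * (j ^ 2 + s ^ 2)) := by gcongr
      _ ≤ (j ^ 2 - s ^ 2) ^ 2 := by
        nlinarith [mul_nonneg (mul_nonneg (sq_nonneg s) (sq_nonneg j)) (sub_nonneg.2 hJ),
          mul_nonneg (sq_nonneg s) (sq_nonneg j), sq_nonneg (s ^ 2), sq_nonneg (s ^ 2 * j)]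
  have e : cos (π * s) ^ 2 / (π * (s + j)) ^ 2 + cos (π * s) ^ 2 / (π * (s - j)) ^ 2 =
      2 * (cos (π * s) ^ 2 * (j ^ 2 + s ^ 2)) / (π ^ 2 * (j ^ 2 - s ^ 2) ^ 2) := by
    have h1 : s - j ≠ 0 := by linarith
    have h2 : j ^ 2 - s ^ 2 ≠ 0 := by
      rw [show j ^ 2 - s ^ 2 = (s + j) * (j - s) by ring]; positivity
    field_simp
    ring
  have hjs : 0 < j ^ 2 - s ^ 2 := by
    rw [show j ^ 2 - s ^ 2 = (s + j) * (j - s) by ring]; positivity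
  rw [e, inv_pow, ← div_eq_mul_inv, div_le_div_iff₀ (by positivity) (by positivity)]
  nlinarith [mul_le_mul_of_nonneg_left key (by positivity : 0 ≤ 2 * π ^ 2)]

/-- Both full series sum to `1` by Parseval, and the tails compare the other way. -/
lemma sum_norm_cellKernel_sq_half_le {t : ℝ} (ht : t ∈ Set.Icc (0 : ℝ) 1) {N : ℕ} (hN : 1 ≤ N) :
    ∑ m ∈ Finset.range N, 2 * (π * (m + 1 / 2))⁻¹ ^ 2 ≤
      ∑ m ∈ Finset.range N, (‖cellKernel (t + m)‖ ^ 2 + ‖cellKernel (t - (m + 1))‖ ^ 2) := by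
  have hs (t : ℝ) : HasSum (fun m : ℕ => ‖cellKernel (t + m)‖ ^ 2 + ‖cellKernel (t - (m + 1))‖ ^ 2)
      1 := by
    simpa [sub_eq_add_neg] using (hasSum_norm_cellKernel_sq t).nat_add_neg_add_one
  have hh : HasSum (fun m : ℕ => 2 * (π * (m + 1 / 2))⁻¹ ^ 2) 1 := by
    convert hs (1 / 2) using 2 with m
    rw [(norm_cellKernel_sq_half m).1, (norm_cellKernel_sq_half m).2]
    ring
  have h₁ := (hs t).summable.sum_add_tsum_nat_add N
  have h₂ := hh.summable.sum_add_tsum_nat_add N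
  rw [(hs t).tsum_eq] at h₁
  rw [hh.tsum_eq] at h₂
  have h₃ := Summable.tsum_le_tsum (fun m : ℕ => norm_cellKernel_sq_pair_le ht
    (show 1 ≤ m + N by omega)) ((summable_nat_add_iff N).2 (hs t).summable)
    ((summable_nat_add_iff N).2 hh.summable)
  linarith

/-- The convex function `x ↦ x ^ r` lies above its tangent line at `a`. -/
lemma rpow_add_mul_sub_le_rpow {a x r : ℝ} (ha : 0 < a) (hx : 0 ≤ x) (hr : 1 ≤ r) :
    a ^ r + r * a ^ (r - 1) * (x - a) ≤ x ^ r := by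
  have h := one_add_mul_self_le_rpow_one_add (s := x / a - 1) (p := r)
    (by have : 0 ≤ x / a := by positivity
        linarith) hr
  rw [add_sub_cancel, div_rpow hx ha.le, le_div_iff₀ (by positivity)] at h
  rw [rpow_sub_one ha.ne']
  calc a ^ r + r * (a ^ r / a) * (x - a) = (1 + r * (x / a - 1)) * a ^ r := by
        field_simp
    _ ≤ x ^ r := h

/-- For `q ≥ 2` the power sums of the kernel along `t + ℤ` are smallest at `t = 1 / 2`. -/
theorem kernelPowerSum_half_le {q : ℝ} (hq : 2 ≤ q) {N : ℕ} (hN : 1 ≤ N) {t : ℝ}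
    (ht : t ∈ Set.Icc (0 : ℝ) 1) : kernelPowerSum q N (1 / 2) ≤ kernelPowerSum q N t := by
  have hr : 1 ≤ q / 2 := by linarith
  set a : ℕ → ℝ := fun m => (π * (m + 1 / 2))⁻¹ ^ 2 with ha
  have ha0 (m : ℕ) : 0 < a m := by positivity
  have hpow (x : ℝ) : ‖cellKernel x‖ ^ q = (‖cellKernel x‖ ^ 2) ^ (q / 2) := by
    rw [← rpow_natCast, ← rpow_mul (norm_nonneg _)]
    congr 1; push_cast; ring
  have hsum := sum_norm_cellKernel_sq_half_le ht hN
  simp only [kernelPowerSum, sum_Ico_neg_eq_sum_range, hpow]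
  push_cast
  simp only [← sub_eq_add_neg]
  rw [← sub_nonneg, ← Finset.sum_sub_distrib]
  calc (0 : ℝ) ≤ q / 2 * a 0 ^ (q / 2 - 1) * (∑ m ∈ Finset.range N,
        (‖cellKernel (t + m)‖ ^ 2 + ‖cellKernel (t - (m + 1))‖ ^ 2 - 2 * a m)) := by
        refine mul_nonneg (by positivity) ?_
        rw [Finset.sum_sub_distrib]
        exact sub_nonneg.2 hsum
    _ = ∑ m ∈ Finset.range N, q / 2 * a 0 ^ (q / 2 - 1) *
        (‖cellKernel (t + m)‖ ^ 2 + ‖cellKernel (t - (m + 1))‖ ^ 2 - 2 * a m) := Finset.mul_sum ..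
    _ ≤ ∑ m ∈ Finset.range N, q / 2 * a m ^ (q / 2 - 1) *
        (‖cellKernel (t + m)‖ ^ 2 + ‖cellKernel (t - (m + 1))‖ ^ 2 - 2 * a m) := by
        refine Finset.sum_le_sum fun m _ => ?_
        rcases Nat.eq_zero_or_pos m with rfl | hm
        · rfl
        -- both the second factor and the difference of the first factors are nonpositive
        refine mul_le_mul_of_nonpos_right ?_ (sub_nonpos.2 (norm_cellKernel_sq_pair_le ht hm))
        have : a m ≤ a 0 := by simp only [ha]; gcongr
        gcongr
    _ ≤ _ := by
        refine Finset.sum_le_sum fun m _ => ?_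
        rw [(norm_cellKernel_sq_half m).1, (norm_cellKernel_sq_half m).2]
        have h₁ := rpow_add_mul_sub_le_rpow (ha0 m) (sq_nonneg ‖cellKernel (t + m)‖) hr
        have h₂ := rpow_add_mul_sub_le_rpow (ha0 m) (sq_nonneg ‖cellKernel (t - (m + 1))‖) hr
        simp only [ha] at h₁ h₂ ⊢
        linarith

lemma kernelPowerSum_half (q : ℝ) (N : ℕ) :
    kernelPowerSum q N (1 / 2) = ∑ m ∈ Finset.range N, 2 * (π * (m + 1 / 2))⁻¹ ^ q := by
  have h1 (m : ℕ) : ‖cellKernel (1 / 2 + m)‖ = (π * (m + 1 / 2))⁻¹ :=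
    (pow_left_inj₀ (norm_nonneg _) (by positivity) two_ne_zero).1 (norm_cellKernel_sq_half m).1
  have h2 (m : ℕ) : ‖cellKernel (1 / 2 - (m + 1))‖ = (π * (m + 1 / 2))⁻¹ :=
    (pow_left_inj₀ (norm_nonneg _) (by positivity) two_ne_zero).1 (norm_cellKernel_sq_half m).2
  rw [kernelPowerSum, sum_Ico_neg_eq_sum_range]
  refine Finset.sum_congr rfl fun m _ => ?_
  push_cast
  rw [← sub_eq_add_neg, h1, h2]
  ring

lemma kernelPowerSum_half_pos (q : ℝ) {N : ℕ} (hN : 1 ≤ N) :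
    0 < kernelPowerSum q N (1 / 2) := by
  rw [kernelPowerSum_half]
  exact Finset.sum_pos (fun m _ => by positivity) ⟨0, Finset.mem_range.2 hN⟩

/-- Splitting `ζ(q) = ∑ n^{-q}` into even and odd `n` evaluates `∑ (n + 1/2)^{-q}`. -/
lemma hasSum_half_zeta {q : ℝ} (hq : 1 < q) :
    HasSum (fun m : ℕ => 2 * (π * (m + 1 / 2))⁻¹ ^ q)
      (2 * ((2 : ℝ) ^ q - 1) * (riemannZeta (q : ℂ)).re / π ^ q) := by
  have hsum : Summable fun n : ℕ => 1 / (n : ℝ) ^ q := summable_one_div_nat_rpow.2 hq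
  have hz : (riemannZeta (q : ℂ)).re = ∑' n : ℕ, 1 / (n : ℝ) ^ q := by
    rw [zeta_eq_tsum_one_div_nat_cpow (by simpa using hq)]
    have : ∀ n : ℕ, 1 / (n : ℂ) ^ (q : ℂ) = ((1 / (n : ℝ) ^ q : ℝ) : ℂ) := fun n => by
      rw [Complex.ofReal_div, Complex.ofReal_cpow n.cast_nonneg]; simp
    simp_rw [this]
    rw [← Complex.ofReal_tsum, Complex.ofReal_re]
  have h2 : (0 : ℝ) < 2 ^ q := by positivity
  have hev (m : ℕ) : 1 / ((2 * m : ℕ) : ℝ) ^ q = (2 ^ q)⁻¹ * (1 / (m : ℝ) ^ q) := by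
    rw [Nat.cast_mul, mul_rpow (Nat.cast_nonneg 2) (Nat.cast_nonneg m), Nat.cast_ofNat,
      one_div, mul_inv, one_div]
  have hodd : Summable fun m : ℕ => 1 / ((2 * m + 1 : ℕ) : ℝ) ^ q :=
    hsum.comp_injective (i := fun m => 2 * m + 1) fun a b h => by simpa using h
  have htot := tsum_even_add_odd (f := fun n : ℕ => 1 / (n : ℝ) ^ q)
    (by simp_rw [hev]; exact hsum.mul_left _) hodd
  simp_rw [hev] at htot
  rw [tsum_mul_left, ← hz] at htot
  have hval : ∑' m : ℕ, 1 / ((2 * m + 1 : ℕ) : ℝ) ^ q =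
      (1 - (2 ^ q)⁻¹) * (riemannZeta (q : ℂ)).re := by linarith
  have hfin := hodd.hasSum.mul_left (2 * (2 : ℝ) ^ q / π ^ q)
  rw [hval] at hfin
  have e1 : 2 * (2 : ℝ) ^ q / π ^ q * ((1 - (2 ^ q)⁻¹) * (riemannZeta (q : ℂ)).re) =
      2 * ((2 : ℝ) ^ q - 1) * (riemannZeta (q : ℂ)).re / π ^ q := by
    field_simp
  rw [e1] at hfin
  refine hfin.congr_fun fun m => ?_
  push_cast
  rw [show (π * (m + 1 / 2 : ℝ))⁻¹ = 2 / (π * (2 * m + 1)) by field_simp,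
    div_rpow zero_le_two (by positivity), mul_rpow pi_pos.le (by positivity)]
  field_simp

lemma tendsto_kernelPowerSum_half {q : ℝ} (hq : 1 < q) :
    Filter.Tendsto (fun N => kernelPowerSum q N (1 / 2)) Filter.atTop
      (nhds (2 * ((2 : ℝ) ^ q - 1) * (riemannZeta (q : ℂ)).re / π ^ q)) := by
  simp_rw [kernelPowerSum_half]
  exact (hasSum_half_zeta hq).tendsto_sum_nat

lemma two_div_pi_rpow_le {q : ℝ} (hq : 1 < q) :
    (2 / π) ^ q ≤ 2 * ((2 : ℝ) ^ q - 1) * (riemannZeta (q : ℂ)).re / π ^ q := by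
  refine le_trans ?_ ((hasSum_half_zeta hq).summable.le_tsum 0 (fun m _ => by positivity)
    |>.trans_eq (hasSum_half_zeta hq).tsum_eq)
  have : (π * ((0 : ℕ) + 1 / 2))⁻¹ = 2 / π := by push_cast; field_simp; norm_num
  rw [this]
  have : 0 ≤ (2 / π) ^ q := by positivity
  linarith

/-! ### A compactly supported window adapted to the kernel -/

/-- The function on `(-N, N]` which is proportional to `conj s * ‖s‖ ^ (q - 2)`, where `s` is
`cellKernel`, and is normalised along each coset `x + ℤ` so that
`∑ n, kernelWindow (x + n) * s (x + n) = 1`. -/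
noncomputable def kernelWindow (q : ℝ) (N : ℕ) (x : ℝ) : ℂ :=
  (Set.Ioc (-(N : ℝ)) N).indicator (fun x => (starRingEnd ℂ) (cellKernel x) *
    ((‖cellKernel x‖ ^ (q - 2) / kernelPowerSum q N (x - ⌈x⌉ + 1) : ℝ) : ℂ)) x

lemma measurable_kernelWindow (q : ℝ) (N : ℕ) : Measurable (kernelWindow q N) := by
  unfold kernelWindow kernelPowerSum
  refine Measurable.indicator ?_ measurableSet_Ioc
  have := continuous_cellKernel.measurable
  fun_prop

lemma ceil_add_intCast_of_mem_Ioc {x : ℝ} (hx : x ∈ Set.Ioc (0 : ℝ) 1) (n : ℤ) :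
    (x + n) - ⌈x + n⌉ + 1 = x := by
  have : ⌈x⌉ = 1 := by
    rw [Int.ceil_eq_iff]; constructor <;> push_cast <;> linarith [hx.1, hx.2]
  rw [Int.ceil_add_intCast, this]
  push_cast
  ring

lemma add_intCast_mem_Ioc_iff {x : ℝ} (hx : x ∈ Set.Ioc (0 : ℝ) 1) (N : ℕ) (n : ℤ) :
    x + n ∈ Set.Ioc (-(N : ℝ)) N ↔ n ∈ Finset.Ico (-(N : ℤ)) N := by
  obtain ⟨h0, h1⟩ := hx
  rw [Set.mem_Ioc, Finset.mem_Ico]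
  constructor
  · rintro ⟨ha, hb⟩
    have h2 : (-(N : ℝ)) < n + 1 := by linarith
    have h3 : (n : ℝ) < N := by linarith
    norm_cast at h2 h3
    exact ⟨by omega, h3⟩
  · rintro ⟨ha, hb⟩
    have h2 : (-(N : ℝ)) ≤ n := by exact_mod_cast ha
    have h3 : (n : ℝ) + 1 ≤ N := by exact_mod_cast hb
    constructor <;> linarith

lemma kernelWindow_add_of_mem {q : ℝ} {N : ℕ} {x : ℝ} (hx : x ∈ Set.Ioc (0 : ℝ) 1) {n : ℤ}
    (hn : n ∈ Finset.Ico (-(N : ℤ)) N) :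
    kernelWindow q N (x + n) = (starRingEnd ℂ) (cellKernel (x + n)) *
      ((‖cellKernel (x + n)‖ ^ (q - 2) / kernelPowerSum q N x : ℝ) : ℂ) := by
  rw [kernelWindow, Set.indicator_of_mem ((add_intCast_mem_Ioc_iff hx N n).2 hn),
    ceil_add_intCast_of_mem_Ioc hx]

lemma kernelWindow_add_of_notMem {q : ℝ} {N : ℕ} {x : ℝ} (hx : x ∈ Set.Ioc (0 : ℝ) 1) {n : ℤ}
    (hn : n ∉ Finset.Ico (-(N : ℤ)) N) : kernelWindow q N (x + n) = 0 := by
  rw [kernelWindow, Set.indicator_of_notMem (mt (add_intCast_mem_Ioc_iff hx N n).1 hn)]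

lemma kernelPowerSum_pos {q : ℝ} (hq : 2 ≤ q) {N : ℕ} (hN : 1 ≤ N) {x : ℝ}
    (hx : x ∈ Set.Ioc (0 : ℝ) 1) : 0 < kernelPowerSum q N x :=
  (kernelPowerSum_half_pos q hN).trans_le
    (kernelPowerSum_half_le hq hN (Set.Ioc_subset_Icc_self hx))

lemma sum_kernelWindow_mul_cellKernel {q : ℝ} (hq : 2 ≤ q) {N : ℕ} (hN : 1 ≤ N) {x : ℝ}
    (hx : x ∈ Set.Ioc (0 : ℝ) 1) :
    ∑ n ∈ Finset.Ico (-(N : ℤ)) N, kernelWindow q N (x + n) * cellKernel (x + n) = 1 := by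
  have hpos := kernelPowerSum_pos hq hN hx
  have : ∀ n ∈ Finset.Ico (-(N : ℤ)) N, kernelWindow q N (x + n) * cellKernel (x + n) =
      ((‖cellKernel (x + n)‖ ^ q / kernelPowerSum q N x : ℝ) : ℂ) := fun n hn => by
    have h1 : ‖cellKernel (x + n)‖ ^ q =
        ‖cellKernel (x + n)‖ ^ 2 * ‖cellKernel (x + n)‖ ^ (q - 2) := by
      rw [← rpow_natCast, ← rpow_add_of_nonneg (norm_nonneg _) (by norm_num) (by linarith)]
      congr 1; push_cast; ring
    rw [kernelWindow_add_of_mem hx hn, mul_right_comm, ← Complex.normSq_eq_conj_mul_self,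
      Complex.normSq_eq_norm_sq, ← Complex.ofReal_mul, h1, mul_div_assoc]
  rw [Finset.sum_congr rfl this, ← Complex.ofReal_sum, ← Finset.sum_div]
  change ((kernelPowerSum q N x / kernelPowerSum q N x : ℝ) : ℂ) = 1
  rw [div_self hpos.ne', Complex.ofReal_one]

lemma sum_norm_kernelWindow_rpow_le {p q : ℝ} (hpq : p.HolderConjugate q) (hq : 2 ≤ q) {N : ℕ}
    (hN : 1 ≤ N) {x : ℝ} (hx : x ∈ Set.Ioc (0 : ℝ) 1) :
    ∑ n ∈ Finset.Ico (-(N : ℤ)) N, ‖kernelWindow q N (x + n)‖ ^ p ≤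
      kernelPowerSum q N (1 / 2) ^ (1 - p) := by
  have hpos := kernelPowerSum_pos hq hN hx
  have : ∀ n ∈ Finset.Ico (-(N : ℤ)) N, ‖kernelWindow q N (x + n)‖ ^ p =
      ‖cellKernel (x + n)‖ ^ q / kernelPowerSum q N x ^ p := fun n hn => by
    have h1 : ‖cellKernel (x + n)‖ * ‖cellKernel (x + n)‖ ^ (q - 2) =
        ‖cellKernel (x + n)‖ ^ (q - 1) := by
      nth_rw 1 [← rpow_one ‖cellKernel (x + n)‖]
      rw [← rpow_add_of_nonneg (norm_nonneg _) (by norm_num) (by linarith)]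
      congr 1; ring
    have h2 : (q - 1) * p = q := by
      have := hpq.symm.sub_one_mul_conj; linarith
    rw [kernelWindow_add_of_mem hx hn, norm_mul, RCLike.norm_conj, Complex.norm_real, norm_div,
      norm_of_nonneg hpos.le, norm_of_nonneg (by positivity), ← mul_div_assoc, h1,
      div_rpow (by positivity) hpos.le, ← rpow_mul (norm_nonneg _), h2]
  rw [Finset.sum_congr rfl this, ← Finset.sum_div]
  change kernelPowerSum q N x / kernelPowerSum q N x ^ p ≤ _
  rw [rpow_sub (kernelPowerSum_half_pos q hN), rpow_one]
  have h3 : ∀ y : ℝ, 0 < y → y / y ^ p = (y ^ (p - 1))⁻¹ := fun y hy => by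
    rw [← rpow_neg hy.le, neg_sub, rpow_sub hy, rpow_one]
  rw [h3 _ hpos, h3 _ (kernelPowerSum_half_pos q hN)]
  have := kernelPowerSum_half_pos q hN
  have h4 : 0 ≤ p - 1 := by linarith [hpq.lt]
  gcongr
  exact kernelPowerSum_half_le hq hN (Set.Ioc_subset_Icc_self hx)

/-- The tensor product of `cellKernel` in each coordinate, which is the Fourier transform of the
indicator function of the unit cell. -/
noncomputable def cellKernelPi {d : ℕ} (x : EuclideanSpace ℝ (Fin d)) : ℂ :=
  ∏ i, cellKernel (x i)

/-- The tensor product of `kernelWindow` in each coordinate. -/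
noncomputable def kernelWindowPi {d : ℕ} (q : ℝ) (N : ℕ) (x : EuclideanSpace ℝ (Fin d)) : ℂ :=
  ∏ i, kernelWindow q N (x i)

lemma continuous_cellKernelPi {d : ℕ} : Continuous (cellKernelPi (d := d)) := by
  unfold cellKernelPi
  have := continuous_cellKernel
  fun_prop

lemma norm_cellKernelPi_le_one {d : ℕ} (x : EuclideanSpace ℝ (Fin d)) :
    ‖cellKernelPi x‖ ≤ 1 := by
  rw [cellKernelPi, norm_prod]
  exact Finset.prod_le_one (fun _ _ => norm_nonneg _) fun i _ => norm_cellKernel_le_one _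

lemma measurable_kernelWindowPi {d : ℕ} (q : ℝ) (N : ℕ) :
    Measurable (kernelWindowPi (d := d) q N) := by
  unfold kernelWindowPi
  have := measurable_kernelWindow q N
  fun_prop

/-- The lattice points `n` with `-N ≤ n i < N` for all `i`. -/
noncomputable def latticeBox (d N : ℕ) : Finset (Fin d → ℤ) :=
  Fintype.piFinset fun _ => Finset.Ico (-(N : ℤ)) N

lemma mem_Ioc_of_mem_unitCell_zero {d : ℕ} {x : EuclideanSpace ℝ (Fin d)}
    (hx : x ∈ unitCell (0 : Fin d → ℝ)) (i : Fin d) : x i ∈ Set.Ioc (0 : ℝ) 1 := by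
  simpa using hx i

lemma kernelWindowPi_add_of_notMem {d : ℕ} {q : ℝ} {N : ℕ} {x : EuclideanSpace ℝ (Fin d)}
    (hx : x ∈ unitCell 0) {n : Fin d → ℤ} (hn : n ∉ latticeBox d N) :
    kernelWindowPi q N (x + latticePoint n) = 0 := by
  obtain ⟨i, hi⟩ : ∃ i, n i ∉ Finset.Ico (-(N : ℤ)) N := by
    by_contra! h
    exact hn (Fintype.mem_piFinset.2 h)
  exact Finset.prod_eq_zero (Finset.mem_univ i)
    (kernelWindow_add_of_notMem (mem_Ioc_of_mem_unitCell_zero hx i) hi)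

lemma sum_kernelWindowPi_mul_cellKernelPi {d : ℕ} {q : ℝ} (hq : 2 ≤ q) {N : ℕ} (hN : 1 ≤ N)
    {x : EuclideanSpace ℝ (Fin d)} (hx : x ∈ unitCell 0) :
    ∑ n ∈ latticeBox d N, kernelWindowPi q N (x + latticePoint n) *
      cellKernelPi (x + latticePoint n) = 1 := by
  simp only [kernelWindowPi, cellKernelPi, ← Finset.prod_mul_distrib, PiLp.add_apply,
    latticePoint_apply]
  rw [latticeBox, ← Finset.prod_univ_sum (fun _ => Finset.Ico (-(N : ℤ)) N)
    (fun i n => kernelWindow q N (x i + n) * cellKernel (x i + n))]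
  exact Finset.prod_eq_one fun i _ =>
    sum_kernelWindow_mul_cellKernel hq hN (mem_Ioc_of_mem_unitCell_zero hx i)

lemma sum_norm_kernelWindowPi_rpow_le {d : ℕ} {p q : ℝ} (hpq : p.HolderConjugate q) (hq : 2 ≤ q)
    {N : ℕ} (hN : 1 ≤ N) {x : EuclideanSpace ℝ (Fin d)} (hx : x ∈ unitCell 0) :
    ∑ n ∈ latticeBox d N, ‖kernelWindowPi q N (x + latticePoint n)‖ ^ p ≤
      (kernelPowerSum q N (1 / 2) ^ (1 - p)) ^ d := by
  simp only [kernelWindowPi, norm_prod, PiLp.add_apply, latticePoint_apply]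
  simp only [← Real.finsetProd_rpow _ _ (fun i _ => norm_nonneg _)]
  rw [latticeBox, ← Finset.prod_univ_sum (fun _ => Finset.Ico (-(N : ℤ)) N)
    (fun i n => ‖kernelWindow q N (x i + n)‖ ^ p)]
  refine (Finset.prod_le_prod (fun i _ => Finset.sum_nonneg fun n _ => by positivity) fun i _ =>
    sum_norm_kernelWindow_rpow_le hpq hq hN (mem_Ioc_of_mem_unitCell_zero hx i)).trans_eq ?_
  rw [Finset.prod_const, Finset.card_univ, Fintype.card_fin]

/-! ### Windowed periodic functions -/

lemma cellKernelPi_eq_integral {d : ℕ} (x : EuclideanSpace ℝ (Fin d)) :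
    cellKernelPi x =
      ∫ u in unitCell 0, Complex.exp ((-2 * π * inner ℝ x u : ℝ) * Complex.I) := by
  have h := (measurePreserving_ofLp_unitCell (0 : Fin d → ℝ)).integral_comp
    (MeasurableEquiv.toLp 2 (Fin d → ℝ)).symm.measurableEmbedding
    (fun v : Fin d → ℝ => ∏ i, Complex.exp ((-2 * π * (v i * x i) : ℝ) * Complex.I))
  have hp := integral_fintype_prod_eq_prod (𝕜 := ℂ)
    (μ := fun i : Fin d => volume.restrict (Set.Ioc ((0 : Fin d → ℝ) i) ((0 : Fin d → ℝ) i + 1)))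
    (fun i (v : ℝ) => Complex.exp ((-2 * π * (v * x i) : ℝ) * Complex.I))
  rw [hp] at h
  rw [cellKernelPi]
  convert h.symm using 1
  · refine Finset.prod_congr rfl fun i _ => ?_
    rw [cellKernel, intervalIntegral.integral_of_le zero_le_one]
    simp
  · refine integral_congr_ae (Filter.Eventually.of_forall fun u => ?_)
    simp only
    rw [← Complex.exp_sum, ← Finset.sum_mul, ← Complex.ofReal_sum, ← Finset.mul_sum]
    simp [PiLp.inner_apply]

lemma mFourier_neg_torusMk {d : ℕ} (k : Fin d → ℤ) (x : EuclideanSpace ℝ (Fin d)) :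
    UnitAddTorus.mFourier (-k) (torusMk x) =
      Complex.exp ((-2 * π * inner ℝ x (latticePoint k) : ℝ) * Complex.I) := by
  simp only [UnitAddTorus.mFourier, ContinuousMap.coe_mk, torusMk, Pi.neg_apply,
    fourier_coe_apply]
  rw [← Complex.exp_sum]
  congr 1
  simp only [PiLp.inner_apply, latticePoint_apply, RCLike.inner_apply, conj_trivial]
  push_cast
  rw [Finset.mul_sum, Finset.sum_mul]
  refine Finset.sum_congr rfl fun i _ => ?_
  ring

section VectorValued

variable {X : Type*} [NormedAddCommGroup X] [NormedSpace ℂ X]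

/-- The function on `ℝ^d` obtained by multiplying the periodic function that corresponds to `f`
with `kernelWindowPi q N`. -/
noncomputable def windowLift {d : ℕ} (q : ℝ) (N : ℕ) (f : UnitAddTorus (Fin d) → X)
    (x : EuclideanSpace ℝ (Fin d)) : X :=
  kernelWindowPi q N x • f (torusMk x)

lemma stronglyMeasurable_windowLift {d : ℕ} (q : ℝ) (N : ℕ) {f : UnitAddTorus (Fin d) → X}
    (hf : StronglyMeasurable f) : StronglyMeasurable (windowLift q N f) :=
  (measurable_kernelWindowPi q N).stronglyMeasurable.smul (hf.comp_measurable measurable_torusMk)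

/-- Summing along cosets of `ℤ^d` leaves the periodic factor unchanged, so only the `p`-th power sum
of the window matters. -/
lemma lintegral_windowLift_le {d : ℕ} {p q : ℝ} (hpq : p.HolderConjugate q) (hq : 2 ≤ q) {N : ℕ}
    (hN : 1 ≤ N) {f : UnitAddTorus (Fin d) → X} (hf : StronglyMeasurable f) :
    ∫⁻ x, ‖windowLift q N f x‖ₑ ^ p ≤
      ENNReal.ofReal ((kernelPowerSum q N (1 / 2) ^ (1 - p)) ^ d) *
        ∫⁻ t, ‖f t‖ₑ ^ p ∂torusMeasure d := by
  have hp : 0 ≤ p := hpq.nonneg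
  have hmf : Measurable fun t => ‖f t‖ₑ ^ p := hf.enorm.pow_const p
  have hmeas (n : Fin d → ℤ) :
      Measurable fun x => ‖windowLift q N f (x + latticePoint n)‖ₑ ^ p :=
    (((stronglyMeasurable_windowLift q N hf).enorm).pow_const p).comp (measurable_add_const _)
  rw [lintegral_eq_tsum_unitCell, tsum_eq_sum (s := latticeBox d N)
    (fun n hn => ?_), ← lintegral_finsetSum _ (fun n _ => hmeas n),
    ← (measurePreserving_torusMk (0 : Fin d → ℝ)).lintegral_comp hmf,
    ← lintegral_const_mul _ (show Measurable fun x => ‖f (torusMk x)‖ₑ ^ p from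
      hmf.comp measurable_torusMk)]
  · refine setLIntegral_mono' (measurableSet_unitCell _) fun x hx => ?_
    simp only [windowLift, torusMk_add_latticePoint, enorm_smul, ENNReal.mul_rpow_of_nonneg _ _ hp]
    rw [← Finset.sum_mul]
    gcongr
    have h : ∀ n : Fin d → ℤ, ‖kernelWindowPi q N (x + latticePoint n)‖ₑ ^ p =
        ENNReal.ofReal (‖kernelWindowPi q N (x + latticePoint n)‖ ^ p) := fun n => by
      rw [← ofReal_norm, ENNReal.ofReal_rpow_of_nonneg (norm_nonneg _) hp]
    simp only [h]
    rw [← ENNReal.ofReal_sum_of_nonneg (fun n _ => by positivity)]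
    exact ENNReal.ofReal_le_ofReal (sum_norm_kernelWindowPi_rpow_le hpq hq hN hx)
  · rw [setLIntegral_congr_fun (g := fun _ => 0) (measurableSet_unitCell _), lintegral_zero]
    intro x hx
    simp [windowLift, kernelWindowPi_add_of_notMem hx hn, hpq.pos]

lemma eLpNorm_windowLift_le {d : ℕ} {p q : ℝ≥0∞} (hpq : p.toReal.HolderConjugate q.toReal)
    (hq : 2 ≤ q.toReal) {N : ℕ} (hN : 1 ≤ N) {f : UnitAddTorus (Fin d) → X}
    (hf : StronglyMeasurable f) :
    eLpNorm (windowLift q.toReal N f) p volume ≤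
      ENNReal.ofReal (kernelPowerSum q.toReal N (1 / 2) ^ (-((d : ℝ) / q.toReal))) *
        eLpNorm f p (torusMeasure d) := by
  have hp := hpq.pos
  obtain ⟨hp0, hpt⟩ := ENNReal.toReal_pos_iff.1 hp
  have hm := kernelPowerSum_half_pos q.toReal hN
  rw [eLpNorm_eq_lintegral_rpow_enorm_toReal hp0.ne' hpt.ne,
    eLpNorm_eq_lintegral_rpow_enorm_toReal hp0.ne' hpt.ne]
  calc (∫⁻ x, ‖windowLift q.toReal N f x‖ₑ ^ p.toReal) ^ (1 / p.toReal)
      ≤ (ENNReal.ofReal ((kernelPowerSum q.toReal N (1 / 2) ^ (1 - p.toReal)) ^ d) *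
        ∫⁻ t, ‖f t‖ₑ ^ p.toReal ∂torusMeasure d) ^ (1 / p.toReal) := by
        gcongr
        exact lintegral_windowLift_le hpq hq hN hf
    _ = _ := by
        rw [ENNReal.mul_rpow_of_nonneg _ _ (by positivity),
          ENNReal.ofReal_rpow_of_nonneg (by positivity) (by positivity), ← rpow_natCast,
          ← rpow_mul hm.le, ← rpow_mul hm.le]
        congr 4
        have h1 : (1 - p.toReal) / p.toReal = -(1 / q.toReal) := by
          have := hpq.inv_add_inv_eq_one
          rw [sub_div, div_self hp.ne']
          rw [one_div, one_div]
          linarith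
        calc (1 - p.toReal) * d * (1 / p.toReal) = d * ((1 - p.toReal) / p.toReal) := by ring
          _ = _ := by rw [h1]; ring

lemma measure_cube_lt_top {d : ℕ} (N : ℕ) :
    volume {x : EuclideanSpace ℝ (Fin d) | ∀ i, x i ∈ Set.Ioc (-(N : ℝ)) N} < ∞ := by
  have h : {x : EuclideanSpace ℝ (Fin d) | ∀ i, x i ∈ Set.Ioc (-(N : ℝ)) N} =
      WithLp.ofLp ⁻¹' (Set.univ.pi fun _ => Set.Ioc (-(N : ℝ)) N) := by ext; simp
  rw [h, (PiLp.volume_preserving_ofLp (Fin d)).measure_preimage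
    (MeasurableSet.univ_pi fun _ => measurableSet_Ioc).nullMeasurableSet, volume_pi_pi]
  exact ENNReal.prod_lt_top fun i _ => by simp

lemma integrable_windowLift {d : ℕ} {p : ℝ≥0∞} (hp : 1 ≤ p) (q : ℝ) (N : ℕ)
    {f : UnitAddTorus (Fin d) → X} (h : MemLp (windowLift q N f) p volume) :
    Integrable (windowLift q N f) volume := by
  set K := {x : EuclideanSpace ℝ (Fin d) | ∀ i, x i ∈ Set.Ioc (-(N : ℝ)) N} with hK
  have : IsFiniteMeasure (volume.restrict K) := isFiniteMeasure_restrict.2 (measure_cube_lt_top N).ne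
  have hint : IntegrableOn (windowLift q N f) K volume :=
    (h.restrict K).integrable hp
  rw [integrableOn_iff_integrable_of_support_subset] at hint
  · exact hint
  · intro x hx i
    by_contra hi
    refine hx ?_
    rw [windowLift, kernelWindowPi, Finset.prod_eq_zero (Finset.mem_univ i), zero_smul]
    rw [kernelWindow, Set.indicator_of_notMem hi]

/-- Multiplying the windowed function by the kernel and integrating recovers the Fourier
coefficients, since the products of window and kernel sum to `1` along each coset of `ℤ^d`. -/
lemma integral_mFourier_eq_integral_windowLift [CompleteSpace X] {d : ℕ} {q : ℝ} (hq : 2 ≤ q)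
    {N : ℕ} (hN : 1 ≤ N)
    {f : UnitAddTorus (Fin d) → X} (hf : StronglyMeasurable f)
    (hint : Integrable (windowLift q N f) volume) (k : Fin d → ℤ) :
    ∫ t, UnitAddTorus.mFourier (-k) t • f t ∂torusMeasure d =
      ∫ x, Complex.exp ((-2 * π * inner ℝ x (latticePoint k) : ℝ) * Complex.I) •
        cellKernelPi x • windowLift q N f x := by
  set g : EuclideanSpace ℝ (Fin d) → X := fun x =>
    Complex.exp ((-2 * π * inner ℝ x (latticePoint k) : ℝ) * Complex.I) •
        cellKernelPi x • windowLift q N f x with hg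
  have hgi : Integrable g := by
    have h1 : Integrable (fun x => cellKernelPi x • windowLift q N f x) :=
      hint.bdd_smul 1 continuous_cellKernelPi.aestronglyMeasurable
        (Filter.Eventually.of_forall norm_cellKernelPi_le_one)
    refine h1.bdd_smul 1 (Continuous.aestronglyMeasurable (by fun_prop))
      (Filter.Eventually.of_forall fun x => (Complex.norm_exp_ofReal_mul_I _).le)
  have hgn (n : Fin d → ℤ) (x : EuclideanSpace ℝ (Fin d)) : g (x + latticePoint n) =
      (kernelWindowPi q N (x + latticePoint n) * cellKernelPi (x + latticePoint n)) •
        UnitAddTorus.mFourier (-k) (torusMk x) • f (torusMk x) := by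
    rw [hg]
    simp only
    rw [← mFourier_neg_torusMk, windowLift, torusMk_add_latticePoint, smul_smul, smul_smul,
      smul_smul]
    congr 1
    ring
  have hmf : StronglyMeasurable fun t => UnitAddTorus.mFourier (-k) t • f t :=
    (UnitAddTorus.mFourier (-k)).continuous.stronglyMeasurable.smul hf
  have hsum := hasSum_integral_unitCell hgi
  have hfin : HasSum (fun n : Fin d → ℤ => ∫ x in unitCell 0, g (x + latticePoint n))
      (∑ n ∈ latticeBox d N, ∫ x in unitCell 0, g (x + latticePoint n)) := by
    refine hasSum_sum_of_ne_finset_zero fun n hn => ?_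
    rw [setIntegral_congr_fun (g := fun _ => 0) (measurableSet_unitCell _), integral_zero]
    intro x hx
    simp only [hgn, kernelWindowPi_add_of_notMem hx hn, zero_mul, zero_smul]
  rw [hsum.unique hfin, ← integral_finsetSum _ (fun n _ =>
    (hgi.comp_add_right (latticePoint n)).integrableOn),
    ← (measurePreserving_torusMk (0 : Fin d → ℝ)).map_eq,
    integral_map measurable_torusMk.aemeasurable hmf.aestronglyMeasurable]
  refine setIntegral_congr_fun (measurableSet_unitCell _) fun x hx => ?_
  simp only [hgn]
  rw [← Finset.sum_smul, sum_kernelWindowPi_mul_cellKernelPi hq hN hx, one_smul]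

/-- Multiplication with the kernel averages the Fourier transform over unit cells, by Fubini's
theorem. -/
lemma integral_cellKernelPi_smul_eq [CompleteSpace X] {d : ℕ} {G : EuclideanSpace ℝ (Fin d) → X}
    (hG : Integrable G) (w : EuclideanSpace ℝ (Fin d)) :
    ∫ x, Complex.exp ((-2 * π * inner ℝ x w : ℝ) * Complex.I) • cellKernelPi x • G x =
      ∫ u in unitCell 0, 𝓕 G (u + w) := by
  have hint : Integrable (Function.uncurry fun (u x : EuclideanSpace ℝ (Fin d)) =>
      Complex.exp ((-2 * π * inner ℝ x (u + w) : ℝ) * Complex.I) • G x)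
      ((volume.restrict (unitCell 0)).prod volume) := by
    refine (hG.comp_snd (volume.restrict (unitCell 0))).bdd_smul 1
      (Continuous.aestronglyMeasurable (by fun_prop))
      (Filter.Eventually.of_forall fun x => (Complex.norm_exp_ofReal_mul_I _).le)
  simp only [fourier_eq']
  rw [integral_integral_swap hint]
  refine integral_congr_ae (Filter.Eventually.of_forall fun x => ?_)
  simp only
  rw [integral_smul_const, smul_smul, cellKernelPi_eq_integral, ← integral_const_mul]
  congr 2
  funext u
  rw [← Complex.exp_add, inner_add_right]
  congr 1
  push_cast
  ring

lemma enorm_integral_rpow_le {α Y : Type*} [MeasurableSpace α] {μ : Measure α}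
    [IsProbabilityMeasure μ] [NormedAddCommGroup Y] [NormedSpace ℝ Y] {q : ℝ} (hq : 1 ≤ q)
    {g : α → Y} (hg : AEStronglyMeasurable g μ) :
    ‖∫ a, g a ∂μ‖ₑ ^ q ≤ ∫⁻ a, ‖g a‖ₑ ^ q ∂μ := by
  have h0 : 0 < q := by linarith
  have h1 := eLpNorm_le_eLpNorm_of_exponent_le (p := 1) (q := ENNReal.ofReal q) (μ := μ)
    (by simpa using hq) hg
  rw [eLpNorm_one_eq_lintegral_enorm, eLpNorm_eq_lintegral_rpow_enorm_toReal (by simpa using h0)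
    ENNReal.ofReal_ne_top, ENNReal.toReal_ofReal h0.le, one_div] at h1
  rw [← ENNReal.le_rpow_inv_iff h0]
  exact (enorm_integral_le_lintegral_enorm g).trans h1

lemma continuous_fourier_of_integrable {d : ℕ} {G : EuclideanSpace ℝ (Fin d) → X}
    (hG : Integrable G) : Continuous (𝓕 G) :=
  VectorFourier.fourierIntegral_continuous continuous_fourierChar (by exact continuous_inner) hG

/-- The Fourier coefficients of `f` are averages over unit cells of the Fourier transform of the
windowed lift of `f`. -/
lemma tsum_enorm_integral_mFourier_rpow_le [CompleteSpace X] {d : ℕ} {q : ℝ} (hq : 2 ≤ q) {N : ℕ}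
    (hN : 1 ≤ N) {f : UnitAddTorus (Fin d) → X} (hf : StronglyMeasurable f)
    (hint : Integrable (windowLift q N f) volume) :
    ∑' k : Fin d → ℤ, ‖∫ t, UnitAddTorus.mFourier (-k) t • f t ∂torusMeasure d‖ₑ ^ q ≤
      ∫⁻ x, ‖𝓕 (windowLift q N f) x‖ₑ ^ q := by
  rw [lintegral_eq_tsum_unitCell]
  refine ENNReal.tsum_le_tsum fun k => ?_
  rw [integral_mFourier_eq_integral_windowLift hq hN hf hint, integral_cellKernelPi_smul_eq hint]
  refine enorm_integral_rpow_le (by linarith) (Continuous.aestronglyMeasurable ?_)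
  exact (continuous_fourier_of_integrable hint).comp (continuous_add_const _)

/-! ### From `ℝ^d` to `𝕋^d` -/

lemma enorm_rpow_eq_tsum_enorm_rpow {ι : Type*} {Y : Type*} [NormedAddCommGroup Y] {q : ℝ≥0∞}
    [Fact (1 ≤ q)] (hq : 0 < q.toReal) (a : lp (fun _ : ι => Y) q) :
    ‖a‖ₑ ^ q.toReal = ∑' k, ‖a k‖ₑ ^ q.toReal := by
  have h := lp.norm_rpow_eq_tsum hq a
  have hs := (lp.memℓp a).summable hq
  have e (z : Y) :
      ‖z‖ₑ ^ q.toReal = ENNReal.ofReal (‖z‖ ^ q.toReal) := by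
    rw [← ofReal_norm, ENNReal.ofReal_rpow_of_nonneg (norm_nonneg _) hq.le]
  rw [← ofReal_norm, ENNReal.ofReal_rpow_of_nonneg (norm_nonneg _) hq.le, h,
    ENNReal.ofReal_tsum_of_nonneg (fun k => by positivity) hs]
  simp only [e]

lemma memℓp_of_tsum_enorm_rpow_ne_top {ι : Type*} {Y : Type*} [NormedAddCommGroup Y] {q : ℝ≥0∞}
    {a : ι → Y} (ha : ∑' k, ‖a k‖ₑ ^ q.toReal ≠ ∞) :
    Memℓp a q := by
  refine memℓp_gen ?_
  convert ENNReal.summable_toReal ha using 2 with k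
  rw [← ENNReal.toReal_rpow, toReal_enorm]

lemma two_le_toReal_of_le_two {p q : ℝ≥0∞} (hpq : p.toReal.HolderConjugate q.toReal)
    (hp : p ≤ 2) : 2 ≤ q.toReal := by
  have h2 : p.toReal ≤ 2 := by
    simpa using ENNReal.toReal_mono ENNReal.ofNat_ne_top hp
  have h := hpq.mul_eq_add
  have h1 := hpq.lt
  have h3 := hpq.symm.lt
  nlinarith

lemma integrable_mFourier_smul {d : ℕ} {p : ℝ≥0∞} [Fact (1 ≤ p)]
    (f : Lp X p (torusMeasure d)) (k : Fin d → ℤ) :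
    Integrable (fun t => UnitAddTorus.mFourier (-k) t • (f : UnitAddTorus (Fin d) → X) t)
      (torusMeasure d) := by
  refine ((Lp.memLp f).integrable Fact.out).bdd_smul 1
    (UnitAddTorus.mFourier (-k)).continuous.aestronglyMeasurable
    (Filter.Eventually.of_forall fun t => ?_)
  exact ((UnitAddTorus.mFourier (-k)).norm_coe_le_norm t).trans UnitAddTorus.mFourier_norm.le

section EuclideanToTorus

variable [CompleteSpace X] {d : ℕ} {p q : ℝ≥0∞} [Fact (1 ≤ p)] [Fact (1 ≤ q)]
  {T : Lp X p (volume : Measure (EuclideanSpace ℝ (Fin d))) →L[ℂ]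
    Lp X q (volume : Measure (EuclideanSpace ℝ (Fin d)))}

lemma tsum_enorm_mFourier_rpow_le_of_window (hpq : p.toReal.HolderConjugate q.toReal) (hp2 : p ≤ 2)
    (hT : IsFourierExtensionEuclidean d T) {N : ℕ} (hN : 1 ≤ N) (f : Lp X p (torusMeasure d)) :
    ∑' k : Fin d → ℤ, ‖∫ t, UnitAddTorus.mFourier (-k) t •
      (f : UnitAddTorus (Fin d) → X) t ∂torusMeasure d‖ₑ ^ q.toReal ≤
    (ENNReal.ofReal (‖T‖ * (kernelPowerSum q.toReal N (1 / 2) ^ (-((d : ℝ) / q.toReal)) * ‖f‖)))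
      ^ q.toReal := by
  have hq := two_le_toReal_of_le_two hpq hp2
  have hf := Lp.stronglyMeasurable f
  have hle := eLpNorm_windowLift_le hpq hq hN hf
  have hm := kernelPowerSum_half_pos q.toReal hN
  have hmem : MemLp (windowLift q.toReal N f) p volume :=
    ⟨(stronglyMeasurable_windowLift _ _ hf).aestronglyMeasurable,
      hle.trans_lt (ENNReal.mul_lt_top ENNReal.ofReal_lt_top (Lp.memLp f).2)⟩
  have hint := integrable_windowLift Fact.out q.toReal N hmem
  have hG := hT hmem.toLp (hint.congr hmem.coeFn_toLp.symm)
  obtain ⟨hq0, hqt⟩ := ENNReal.toReal_pos_iff.1 hpq.symm.pos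
  have hnorm : ‖hmem.toLp‖ ≤
      kernelPowerSum q.toReal N (1 / 2) ^ (-((d : ℝ) / q.toReal)) * ‖f‖ := by
    rw [Lp.norm_toLp, Lp.norm_def, ← ENNReal.toReal_ofReal (rpow_nonneg hm.le _),
      ← ENNReal.toReal_mul]
    exact ENNReal.toReal_mono
      (ENNReal.mul_lt_top ENNReal.ofReal_lt_top (Lp.memLp f).2).ne hle
  calc _ ≤ ∫⁻ x, ‖𝓕 (windowLift q.toReal N f) x‖ₑ ^ q.toReal :=
        tsum_enorm_integral_mFourier_rpow_le hq hN hf hint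
    _ = ∫⁻ x, ‖T hmem.toLp x‖ₑ ^ q.toReal := by
        refine lintegral_congr_ae ?_
        filter_upwards [hG] with x hx
        rw [hx, Real.fourier_congr_ae hmem.coeFn_toLp]
    _ = ‖T hmem.toLp‖ₑ ^ q.toReal := by
        rw [Lp.enorm_def, eLpNorm_eq_lintegral_rpow_enorm_toReal hq0.ne' hqt.ne, one_div,
          ENNReal.rpow_inv_rpow hpq.symm.pos.ne']
    _ ≤ _ := by
        rw [← ofReal_norm]
        gcongr
        exact (T.le_opNorm _).trans (by gcongr)

/-- The constant `(2 (2^q - 1) ζ(q) / π^q)^{-d/q}`, the limit of the constants that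
the windows with `N → ∞` give. -/
noncomputable def torusConstant (d : ℕ) (q : ℝ) : ℝ :=
  (2 * ((2 : ℝ) ^ q - 1) * (riemannZeta (q : ℂ)).re / π ^ q) ^ (-((d : ℝ) / q))

lemma tsum_enorm_mFourier_rpow_le (hpq : p.toReal.HolderConjugate q.toReal) (hp2 : p ≤ 2)
    (hT : IsFourierExtensionEuclidean d T) (f : Lp X p (torusMeasure d)) :
    ∑' k : Fin d → ℤ, ‖∫ t, UnitAddTorus.mFourier (-k) t •
      (f : UnitAddTorus (Fin d) → X) t ∂torusMeasure d‖ₑ ^ q.toReal ≤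
    (ENNReal.ofReal (torusConstant d q.toReal * ‖T‖ * ‖f‖)) ^ q.toReal := by
  have hq1 : 1 < q.toReal := hpq.symm.lt
  have hpos : 0 < 2 * ((2 : ℝ) ^ q.toReal - 1) * (riemannZeta (q.toReal : ℂ)).re / π ^ q.toReal :=
    lt_of_lt_of_le (by positivity) (two_div_pi_rpow_le hq1)
  have hlim := ((tendsto_kernelPowerSum_half hq1).rpow_const (p := -((d : ℝ) / q.toReal))
    (Or.inl hpos.ne')).mul_const ‖f‖ |>.const_mul ‖T‖
  have hlim2 := ((ENNReal.continuous_rpow_const (y := q.toReal)).tendsto _).comp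
    ((ENNReal.continuous_ofReal.tendsto _).comp hlim)
  rw [mul_assoc, mul_left_comm]
  refine ge_of_tendsto hlim2 ?_
  filter_upwards [Filter.eventually_ge_atTop 1] with N hN
  exact tsum_enorm_mFourier_rpow_le_of_window hpq hp2 hT hN f

lemma torusConstant_nonneg (d : ℕ) {q : ℝ} (hq : 1 < q) : 0 ≤ torusConstant d q :=
  rpow_nonneg (le_trans (by positivity) (two_div_pi_rpow_le hq)) _

theorem norm_le_of_isFourierExtensionEuclidean (hpq : p.toReal.HolderConjugate q.toReal)
    (hp2 : p ≤ 2) (hT : IsFourierExtensionEuclidean d T)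
    {S : Lp X p (torusMeasure d) →L[ℂ] lp (fun _ : Fin d → ℤ => X) q}
    (hS : IsFourierExtensionTorus d S) : ‖S‖ ≤ torusConstant d q.toReal * ‖T‖ := by
  have h0 := torusConstant_nonneg d hpq.symm.lt
  refine S.opNorm_le_bound (by positivity) fun f => ?_
  have h := tsum_enorm_mFourier_rpow_le hpq hp2 hT f
  simp only [← hS f] at h
  rw [← enorm_rpow_eq_tsum_enorm_rpow hpq.symm.pos, ENNReal.rpow_le_rpow_iff hpq.symm.pos,
    ← ofReal_norm, ENNReal.ofReal_le_ofReal_iff (by positivity)] at h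
  exact h

theorem exists_isFourierExtensionTorus (hpq : p.toReal.HolderConjugate q.toReal)
    (hp2 : p ≤ 2) (hT : IsFourierExtensionEuclidean d T) :
    ∃ S : Lp X p (torusMeasure d) →L[ℂ] lp (fun _ : Fin d → ℤ => X) q,
      IsFourierExtensionTorus d S := by
  have hmem (f : Lp X p (torusMeasure d)) : Memℓp (fun k : Fin d → ℤ =>
      ∫ t, UnitAddTorus.mFourier (-k) t • (f : UnitAddTorus (Fin d) → X) t ∂torusMeasure d) q :=
    memℓp_of_tsum_enorm_rpow_ne_top
      ((tsum_enorm_mFourier_rpow_le hpq hp2 hT f).trans_lt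
        (ENNReal.rpow_lt_top_of_nonneg hpq.symm.nonneg ENNReal.ofReal_ne_top)).ne
  let L : Lp X p (torusMeasure d) →ₗ[ℂ] lp (fun _ : Fin d → ℤ => X) q :=
    { toFun := fun f => ⟨_, hmem f⟩
      map_add' := fun f g => by
        ext k
        simp only [lp.coeFn_add, Pi.add_apply]
        rw [← integral_add (integrable_mFourier_smul f k) (integrable_mFourier_smul g k)]
        refine integral_congr_ae ?_
        filter_upwards [Lp.coeFn_add f g] with t ht
        rw [ht, Pi.add_apply, smul_add]
      map_smul' := fun c f => by
        ext k
        simp only [lp.coeFn_smul, Pi.smul_apply, RingHom.id_apply]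
        rw [← integral_smul]
        refine integral_congr_ae ?_
        filter_upwards [Lp.coeFn_smul c f] with t ht
        rw [ht, Pi.smul_apply, smul_comm] }
  refine ⟨L.mkContinuous (torusConstant d q.toReal * ‖T‖) fun f => ?_, fun f k => rfl⟩
  have h0 := torusConstant_nonneg d hpq.symm.lt
  rw [← ENNReal.ofReal_le_ofReal_iff (by positivity), ofReal_norm,
    ← ENNReal.rpow_le_rpow_iff hpq.symm.pos, enorm_rpow_eq_tsum_enorm_rpow hpq.symm.pos]
  exact tsum_enorm_mFourier_rpow_le hpq hp2 hT f

end EuclideanToTorus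

lemma torusConstant_eq (d : ℕ) {q : ℝ} (hq : 1 < q) :
    torusConstant d q =
      π ^ d / (2 * ((2 : ℝ) ^ q - 1) * (riemannZeta (q : ℂ)).re) ^ ((d : ℝ) / q) := by
  have hpos : 0 < 2 * ((2 : ℝ) ^ q - 1) * (riemannZeta (q : ℂ)).re / π ^ q :=
    lt_of_lt_of_le (by positivity) (two_div_pi_rpow_le hq)
  have h2 : 0 < 2 * ((2 : ℝ) ^ q - 1) * (riemannZeta (q : ℂ)).re := by
    have : 0 < π ^ q := by positivity
    rw [div_pos_iff] at hpos
    rcases hpos with h | h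
    · exact h.1
    · linarith [h.2]
  rw [torusConstant, rpow_neg hpos.le, div_rpow h2.le (by positivity), ← rpow_mul pi_pos.le,
    mul_div_cancel₀ _ (by linarith : q ≠ 0), rpow_natCast, inv_div]

lemma torusConstant_le (d : ℕ) {q : ℝ} (hq : 1 < q) : torusConstant d q ≤ (π / 2) ^ d := by
  rw [torusConstant]
  calc _ ≤ ((2 / π) ^ q) ^ (-((d : ℝ) / q)) :=
        rpow_le_rpow_of_nonpos (by positivity) (two_div_pi_rpow_le hq)
          (neg_nonpos.2 (by positivity))
    _ = (π / 2) ^ d := by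
        rw [← rpow_mul (by positivity), mul_neg, mul_div_cancel₀ _ (by linarith : q ≠ 0),
          rpow_neg (by positivity), rpow_natCast, ← inv_pow, inv_div]

/-! ### From `𝕋^d` to `ℝ^d` -/

section TorusToEuclidean

variable {d : ℕ} {p q : ℝ≥0∞} [Fact (1 ≤ p)] [Fact (1 ≤ q)]
  {S : Lp X p (torusMeasure d) →L[ℂ] lp (fun _ : Fin d → ℤ => X) q}

/-- A function supported in a unit cell is a function on the torus, with Fourier coefficients the
values of its Fourier transform on the lattice. -/
lemma tsum_enorm_fourier_latticePoint_rpow_le (hq : 0 < q.toReal)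
    (hS : IsFourierExtensionTorus d S) {a : Fin d → ℝ} {h : EuclideanSpace ℝ (Fin d) → X}
    (hh : MemLp h p volume) (hsupp : ∀ x ∉ unitCell a, h x = 0) :
    ∑' k : Fin d → ℤ, ‖𝓕 h (latticePoint k)‖ₑ ^ q.toReal ≤
      (‖S‖ₑ * eLpNorm h p volume) ^ q.toReal := by
  have hsec := measurePreserving_torusSection a
  have hg : MemLp (h ∘ torusSection a) p (torusMeasure d) :=
    (hh.restrict (unitCell a)).comp_measurePreserving hsec
  have hcoef (k : Fin d → ℤ) : S hg.toLp k = 𝓕 h (latticePoint k) := by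
    have hm : AEStronglyMeasurable (fun x : EuclideanSpace ℝ (Fin d) =>
        Complex.exp ((-2 * π * inner ℝ x (latticePoint k) : ℝ) * Complex.I) • h x)
        (volume.restrict (unitCell a)) :=
      (Continuous.aestronglyMeasurable (by fun_prop)).smul hh.1.restrict
    rw [hS, fourier_eq', ← setIntegral_eq_integral_of_forall_compl_eq_zero (s := unitCell a)
      (fun x hx => by rw [hsupp x hx, smul_zero]), ← hsec.map_eq,
      integral_map hsec.measurable.aemeasurable (hsec.map_eq.symm ▸ hm)]
    refine integral_congr_ae ?_
    filter_upwards [hg.coeFn_toLp] with t ht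
    rw [ht, ← mFourier_neg_torusMk, torusMk_torusSection, Function.comp_apply]
  simp only [← hcoef]
  rw [← enorm_rpow_eq_tsum_enorm_rpow hq]
  gcongr
  refine (S.le_opENorm _).trans ?_
  gcongr
  rw [Lp.enorm_toLp, eLpNorm_comp_measurePreserving hh.1.restrict hsec]
  exact eLpNorm_restrict_le _ _ _ _

/-- Modulating `h` translates its Fourier transform, so the values on each translate of `ℤ^d` are
controlled in `ℓ^q`; these bounds are averaged over the translates. -/
lemma eLpNorm_fourier_le_of_unitCell (hq0 : 0 < q.toReal)
    (hS : IsFourierExtensionTorus d S) {a : Fin d → ℝ} {h : EuclideanSpace ℝ (Fin d) → X}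
    (hh : MemLp h p volume) (hsupp : ∀ x ∉ unitCell a, h x = 0) (hint : Integrable h volume) :
    eLpNorm (𝓕 h) q volume ≤ ‖S‖ₑ * eLpNorm h p volume := by
  obtain ⟨hq, hqt⟩ := ENNReal.toReal_pos_iff.1 hq0
  have hcont := continuous_fourier_of_integrable hint
  rw [eLpNorm_eq_lintegral_rpow_enorm_toReal hq.ne' hqt.ne, one_div, ENNReal.rpow_inv_le_iff hq0,
    lintegral_eq_tsum_unitCell, ← lintegral_tsum (fun n => Measurable.aemeasurable <|
      Measurable.pow_const (Continuous.measurable (by fun_prop)) _)]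
  have hθ (θ : EuclideanSpace ℝ (Fin d)) :
      ∑' n : Fin d → ℤ, ‖𝓕 h (θ + latticePoint n)‖ₑ ^ q.toReal ≤
        (‖S‖ₑ * eLpNorm h p volume) ^ q.toReal := by
    set m : EuclideanSpace ℝ (Fin d) → X := fun x =>
      Complex.exp ((-2 * π * inner ℝ x θ : ℝ) * Complex.I) • h x with hm
    have hnorm (x : EuclideanSpace ℝ (Fin d)) : ‖m x‖ = ‖h x‖ := by
      rw [hm]; simp only [norm_smul, Complex.norm_exp_ofReal_mul_I, one_mul]
    have hmm : MemLp m p volume := hh.of_le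
      ((Continuous.aestronglyMeasurable (by fun_prop)).smul hh.1)
      (Filter.Eventually.of_forall fun x => (hnorm x).le)
    have heq : eLpNorm m p volume = eLpNorm h p volume :=
      eLpNorm_congr_norm_ae (Filter.Eventually.of_forall hnorm)
    have hF (w : EuclideanSpace ℝ (Fin d)) : 𝓕 h (θ + w) = 𝓕 m w := by
      simp only [fourier_eq', hm, smul_smul]
      congr 1
      funext x
      rw [← Complex.exp_add, inner_add_right]
      congr 2
      push_cast
      ring
    simp only [hF]
    rw [← heq]
    exact tsum_enorm_fourier_latticePoint_rpow_le (a := a) hq0 hS hmm fun x hx => by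
      rw [hm]; simp only [hsupp x hx, smul_zero]
  calc _ ≤ ∫⁻ _ in unitCell (0 : Fin d → ℝ), (‖S‖ₑ * eLpNorm h p volume) ^ q.toReal :=
        lintegral_mono hθ
    _ = _ := by rw [lintegral_const, measure_univ, mul_one]

lemma eLpNorm_comp_smul {Y : Type*} [NormedAddCommGroup Y] {r : ℝ≥0∞} (hr : r ≠ ∞) {c : ℝ}
    (hc : 0 < c) {f : EuclideanSpace ℝ (Fin d) → Y} (hf : AEStronglyMeasurable f volume) :
    eLpNorm (fun x => f (c • x)) r volume =
      (ENNReal.ofReal (c ^ d)⁻¹) ^ (1 / r.toReal) * eLpNorm f r volume := by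
  have hmap := Measure.map_addHaar_smul (volume : Measure (EuclideanSpace ℝ (Fin d))) hc.ne'
  rw [finrank_euclideanSpace_fin, abs_of_pos (by positivity)] at hmap
  have hf' : AEStronglyMeasurable f
      (Measure.map (c • · : EuclideanSpace ℝ (Fin d) → EuclideanSpace ℝ (Fin d)) volume) := by
    rw [hmap]; exact hf.smul_measure _
  have := eLpNorm_map_measure (p := r) hf' (measurable_const_smul c).aemeasurable
  rw [hmap, eLpNorm_smul_measure_of_ne_top hr, smul_eq_mul, ENNReal.toReal_div,
    ENNReal.toReal_one] at this
  exact this.symm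

lemma fourier_comp_smul {c : ℝ} (hc : 0 < c) (f : EuclideanSpace ℝ (Fin d) → X)
    (w : EuclideanSpace ℝ (Fin d)) :
    𝓕 (fun x => f (c • x)) w = ((c ^ d)⁻¹ : ℝ) • 𝓕 f (c⁻¹ • w) := by
  have h := Measure.integral_comp_smul (volume : Measure (EuclideanSpace ℝ (Fin d)))
    (fun v => Complex.exp ((-2 * π * inner ℝ v (c⁻¹ • w) : ℝ) * Complex.I) • f v) c
  rw [finrank_euclideanSpace_fin, abs_of_pos (by positivity)] at h
  rw [fourier_eq', fourier_eq', ← h]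
  congr 1
  funext x
  rw [real_inner_smul_left, real_inner_smul_right, ← mul_assoc c, mul_inv_cancel₀ hc.ne', one_mul]

/-- The inequality for functions with bounded support follows from the one for functions supported
in a unit cell by dilation, as both sides have the same homogeneity when `1 / p + 1 / q = 1`. -/
lemma eLpNorm_fourier_le_of_cube (hpq : p.toReal.HolderConjugate q.toReal)
    (hS : IsFourierExtensionTorus d S) {N : ℕ} (hN : 1 ≤ N) {f : EuclideanSpace ℝ (Fin d) → X}
    (hf : MemLp f p volume) (hint : Integrable f volume)
    (hsupp : ∀ x, (¬ ∀ i, x i ∈ Set.Ioc (-(N : ℝ)) N) → f x = 0) :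
    eLpNorm (𝓕 f) q volume ≤ ‖S‖ₑ * eLpNorm f p volume := by
  obtain ⟨hq0, hqt⟩ := ENNReal.toReal_pos_iff.1 hpq.symm.pos
  obtain ⟨hp0, hpt⟩ := ENNReal.toReal_pos_iff.1 hpq.pos
  have hN' : (1 : ℝ) ≤ N := by exact_mod_cast hN
  -- dilation by `2 N` maps the unit cell centred at `0` onto the cube `(-N, N]^d`
  obtain ⟨c, hc⟩ : ∃ c : ℝ, c = 2 * N := ⟨_, rfl⟩
  have hc0 : 0 < c := by linarith
  have hpnorm := eLpNorm_comp_smul hpt.ne hc0 hf.1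
  have hmeas : AEStronglyMeasurable (fun x => f (c • x)) volume :=
    (hint.comp_smul hc0.ne').1
  have key := eLpNorm_fourier_le_of_unitCell (a := fun _ => -(1 / 2)) hpq.symm.pos hS
    (h := fun x => f (c • x)) ⟨hmeas, hpnorm ▸ ENNReal.mul_lt_top
      (ENNReal.rpow_lt_top_of_nonneg (by positivity) ENNReal.ofReal_ne_top) hf.2⟩
    (fun x hx => hsupp _ fun hcx => hx fun i => by
      have := hcx i
      simp only [PiLp.smul_apply, smul_eq_mul, hc, Set.mem_Ioc] at this ⊢
      constructor <;> nlinarith) (hint.comp_smul hc0.ne')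
  have hF : 𝓕 (fun x => f (c • x)) = ((c ^ d)⁻¹ : ℝ) • fun w => 𝓕 f (c⁻¹ • w) :=
    funext fun w => fourier_comp_smul hc0 f w
  rw [hpnorm, hF, eLpNorm_const_smul, eLpNorm_comp_smul hqt.ne (inv_pos.2 hc0)
    (continuous_fourier_of_integrable hint).aestronglyMeasurable] at key
  set D : ℝ := (c ^ d)⁻¹ with hD
  have hD0 : 0 < D := by positivity
  have e1 : ‖D‖ₑ = ENNReal.ofReal D := Real.enorm_of_nonneg hD0.le
  have e2 : (c⁻¹ ^ d)⁻¹ = D⁻¹ := by rw [inv_pow]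
  -- the powers of `D` on both sides agree since `1 - 1 / q = 1 / p`
  have e3 : ENNReal.ofReal D * ENNReal.ofReal D⁻¹ ^ (1 / q.toReal) =
      ENNReal.ofReal D ^ (1 / p.toReal) := by
    rw [ENNReal.ofReal_rpow_of_pos hD0, ENNReal.ofReal_rpow_of_pos (inv_pos.2 hD0),
      ← ENNReal.ofReal_mul hD0.le, inv_rpow hD0.le, ← rpow_neg hD0.le]
    congr 1
    nth_rw 1 [← rpow_one D]
    rw [← rpow_add hD0]
    congr 1
    have := hpq.inv_add_inv_eq_one
    rw [one_div, one_div]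
    linarith
  rw [e1, e2, ← mul_assoc, e3, mul_left_comm] at key
  exact (ENNReal.mul_le_mul_iff_right (ENNReal.rpow_pos (by simpa using hD0)
    ENNReal.ofReal_ne_top).ne' (ENNReal.rpow_ne_top_of_nonneg (by positivity)
    ENNReal.ofReal_ne_top)).1 key

/-- The general case follows by truncation and Fatou's lemma. -/
theorem eLpNorm_fourier_le (hpq : p.toReal.HolderConjugate q.toReal)
    (hS : IsFourierExtensionTorus d S) {f : EuclideanSpace ℝ (Fin d) → X}
    (hf : MemLp f p volume) (hint : Integrable f volume) :
    eLpNorm (𝓕 f) q volume ≤ ‖S‖ₑ * eLpNorm f p volume := by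
  set K : ℕ → Set (EuclideanSpace ℝ (Fin d)) := fun N => {x | ∀ i, x i ∈ Set.Ioc (-(N : ℝ)) N}
    with hK
  have hKm (N : ℕ) : MeasurableSet (K N) := by
    have : K N = WithLp.ofLp ⁻¹' (Set.univ.pi fun _ => Set.Ioc (-(N : ℝ)) N) := by ext; simp [hK]
    rw [this]
    exact WithLp.measurable_ofLp 2 _ (MeasurableSet.univ_pi fun _ => measurableSet_Ioc)
  have hev (x : EuclideanSpace ℝ (Fin d)) : ∀ᶠ N : ℕ in Filter.atTop, x ∈ K N := by
    simp only [hK, Set.mem_ofPred_eq]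
    rw [Filter.eventually_all]
    intro i
    filter_upwards [(tendsto_natCast_atTop_atTop (R := ℝ)).eventually_gt_atTop |x i|] with N hN
    exact ⟨(abs_lt.1 hN).1, (abs_lt.1 hN).2.le⟩
  refine Lp.eLpNorm_le_of_ae_tendsto (u := Filter.atTop) (f := fun N => 𝓕 ((K N).indicator f))
    ?_ (fun N => (continuous_fourier_of_integrable (hint.indicator (hKm N))).aestronglyMeasurable)
    (Filter.Eventually.of_forall fun w => ?_)
  · filter_upwards [Filter.eventually_ge_atTop 1] with N hN
    refine (eLpNorm_fourier_le_of_cube hpq hS hN (hf.indicator (hKm N))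
      (hint.indicator (hKm N)) fun x hx =>
      Set.indicator_of_notMem (show x ∉ K N from hx) f).trans ?_
    gcongr
    exact eLpNorm_indicator_le f
  · simp only [fourier_eq']
    refine tendsto_integral_of_dominated_convergence (fun x => ‖f x‖)
      (fun N => (Continuous.aestronglyMeasurable (by fun_prop)).smul
        (hint.indicator (hKm N)).1) hint.norm
      (fun N => Filter.Eventually.of_forall fun x => ?_)
      (Filter.Eventually.of_forall fun x => ?_)
    · rw [norm_smul, Complex.norm_exp_ofReal_mul_I, one_mul]
      exact norm_indicator_le_norm_self f x
    · refine tendsto_const_nhds.congr' ?_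
      filter_upwards [hev x] with N hN
      rw [Set.indicator_of_mem hN]

lemma fourier_add_of_integrable {f g : EuclideanSpace ℝ (Fin d) → X} (hf : Integrable f)
    (hg : Integrable g) (w : EuclideanSpace ℝ (Fin d)) : 𝓕 (f + g) w = 𝓕 f w + 𝓕 g w :=
  congrFun (VectorFourier.fourierIntegral_add (L := innerₗ (EuclideanSpace ℝ (Fin d)))
    continuous_fourierChar (by exact continuous_inner) hf hg) w

lemma fourier_const_smul_apply (c : ℂ) (f : EuclideanSpace ℝ (Fin d) → X)
    (w : EuclideanSpace ℝ (Fin d)) : 𝓕 (c • f) w = c • 𝓕 f w :=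
  congrFun (VectorFourier.fourierIntegral_const_smul 𝐞 volume
    (innerₗ (EuclideanSpace ℝ (Fin d))) f c) w

/-- The subspace `L^1 ∩ L^p` of `L^p(ℝ^d; X)`. -/
def integrableSubmodule (d : ℕ) (X : Type*) [NormedAddCommGroup X] [NormedSpace ℂ X]
    (p : ℝ≥0∞) [Fact (1 ≤ p)] :
    Submodule ℂ (Lp X p (volume : Measure (EuclideanSpace ℝ (Fin d)))) where
  carrier := {f | Integrable f volume}
  zero_mem' := (integrable_zero _ _ _).congr (Lp.coeFn_zero X p volume).symm
  add_mem' {f g} hf hg := (Integrable.add hf hg).congr (Lp.coeFn_add f g).symm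
  smul_mem' c f hf := (Integrable.smul c hf).congr (Lp.coeFn_smul c f).symm

lemma denseRange_integrableSubmodule (hp0 : p ≠ 0) (hpt : p ≠ ∞) :
    DenseRange (integrableSubmodule d X p).subtype := by
  refine (Lp.simpleFunc.dense (E := X) (μ := (volume : Measure (EuclideanSpace ℝ (Fin d)))) hpt).mono
    fun f hf => ?_
  let g : Lp.simpleFunc X p (volume : Measure (EuclideanSpace ℝ (Fin d))) := ⟨f, hf⟩
  refine ⟨⟨f, ?_⟩, rfl⟩
  exact ((SimpleFunc.memLp_iff_integrable hp0 hpt).1 (Lp.simpleFunc.memLp g)).congr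
    (Lp.simpleFunc.toSimpleFunc_eq_toFun g)

lemma memLp_fourier (hpq : p.toReal.HolderConjugate q.toReal)
    (hS : IsFourierExtensionTorus d S) (f : integrableSubmodule d X p) :
    MemLp (𝓕 ((f : Lp X p volume) : EuclideanSpace ℝ (Fin d) → X)) q volume :=
  ⟨(continuous_fourier_of_integrable f.2).aestronglyMeasurable,
    (eLpNorm_fourier_le hpq hS (Lp.memLp f.1) f.2).trans_lt
      (ENNReal.mul_lt_top enorm_lt_top (Lp.memLp f.1).2)⟩

/-- The Fourier integral as a linear map from `L^1 ∩ L^p` to `L^q`. -/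
noncomputable def fourierIntegrableLinearMap (hpq : p.toReal.HolderConjugate q.toReal)
    (hS : IsFourierExtensionTorus d S) :
    integrableSubmodule d X p →ₗ[ℂ] Lp X q (volume : Measure (EuclideanSpace ℝ (Fin d))) where
  toFun f := (memLp_fourier hpq hS f).toLp
  map_add' f g := by
    rw [← MemLp.toLp_add]
    refine MemLp.toLp_congr _ _ (Filter.Eventually.of_forall fun w => ?_)
    rw [Submodule.coe_add, Real.fourier_congr_ae (Lp.coeFn_add f.1 g.1)]
    exact fourier_add_of_integrable f.2 g.2 w
  map_smul' c f := by
    rw [RingHom.id_apply, ← MemLp.toLp_const_smul]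
    refine MemLp.toLp_congr _ _ (Filter.Eventually.of_forall fun w => ?_)
    rw [Submodule.coe_smul, Real.fourier_congr_ae (Lp.coeFn_smul c f.1)]
    exact fourier_const_smul_apply c _ w

lemma norm_fourierIntegrableLinearMap_le (hpq : p.toReal.HolderConjugate q.toReal)
    (hS : IsFourierExtensionTorus d S) (f : integrableSubmodule d X p) :
    ‖fourierIntegrableLinearMap hpq hS f‖ ≤ ‖S‖ * ‖(integrableSubmodule d X p).subtype f‖ := by
  have h := eLpNorm_fourier_le hpq hS (Lp.memLp f.1) f.2
  rw [Submodule.subtype_apply, Lp.norm_def f.1, ← toReal_enorm S, ← ENNReal.toReal_mul]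
  refine (Lp.norm_toLp _ (memLp_fourier hpq hS f)).trans_le (ENNReal.toReal_mono ?_ h)
  exact (ENNReal.mul_lt_top enorm_lt_top (Lp.memLp f.1).2).ne

theorem exists_isFourierExtensionEuclidean [CompleteSpace X]
    (hpq : p.toReal.HolderConjugate q.toReal) (hS : IsFourierExtensionTorus d S) :
    ∃ T : Lp X p (volume : Measure (EuclideanSpace ℝ (Fin d))) →L[ℂ]
      Lp X q (volume : Measure (EuclideanSpace ℝ (Fin d))), IsFourierExtensionEuclidean d T := by
  obtain ⟨hp0, hpt⟩ := ENNReal.toReal_pos_iff.1 hpq.pos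
  obtain ⟨T, hT⟩ : ∃ T : Lp X p (volume : Measure (EuclideanSpace ℝ (Fin d))) →L[ℂ]
      Lp X q (volume : Measure (EuclideanSpace ℝ (Fin d))),
      ∀ f : integrableSubmodule d X p, T f = fourierIntegrableLinearMap hpq hS f :=
    ⟨(fourierIntegrableLinearMap hpq hS).extendOfNorm (integrableSubmodule d X p).subtype,
      LinearMap.extendOfNorm_eq (denseRange_integrableSubmodule hp0.ne' hpt.ne)
        ⟨‖S‖, norm_fourierIntegrableLinearMap_le hpq hS⟩⟩
  refine ⟨T, fun f hf => ?_⟩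
  have h : T f = (memLp_fourier hpq hS ⟨f, hf⟩).toLp := hT ⟨f, hf⟩
  rw [h]
  exact (memLp_fourier hpq hS ⟨f, hf⟩).coeFn_toLp

theorem norm_le_of_isFourierExtensionTorus (hpq : p.toReal.HolderConjugate q.toReal)
    (hS : IsFourierExtensionTorus d S)
    {T : Lp X p (volume : Measure (EuclideanSpace ℝ (Fin d))) →L[ℂ]
      Lp X q (volume : Measure (EuclideanSpace ℝ (Fin d)))}
    (hT : IsFourierExtensionEuclidean d T) : ‖T‖ ≤ ‖S‖ := by
  obtain ⟨hp0, hpt⟩ := ENNReal.toReal_pos_iff.1 hpq.pos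
  refine T.opNorm_le_bound (norm_nonneg _) fun f => ?_
  refine (denseRange_integrableSubmodule (d := d) (X := X) hp0.ne' hpt.ne).induction_on
    (p := fun f => ‖T f‖ ≤ ‖S‖ * ‖f‖) f (isClosed_le (by fun_prop) (by fun_prop)) fun g => ?_
  have h := eLpNorm_fourier_le hpq hS (Lp.memLp g.1) g.2
  rw [← eLpNorm_congr_ae (hT g.1 g.2)] at h
  rw [Submodule.subtype_apply, Lp.norm_def, Lp.norm_def, ← toReal_enorm S, ← ENNReal.toReal_mul]
  exact ENNReal.toReal_mono (ENNReal.mul_lt_top enorm_lt_top (Lp.memLp g.1).2).ne h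

end TorusToEuclidean

end VectorValued

/-! ### Equivalence of Fourier type on `ℝ^d` and on `𝕋^d` -/

theorem mainTheorem2 {X : Type*} [NormedAddCommGroup X] [NormedSpace ℂ X] [CompleteSpace X]
    (d : ℕ) (hd : 1 ≤ d) (p q : ℝ≥0∞) [Fact (1 ≤ p)] [Fact (1 ≤ q)]
    (hp1 : 1 < p) (hp2 : p ≤ 2) (hpq : 1 / p + 1 / q = 1) :
    ((∃ T : Lp X p (volume : Measure (EuclideanSpace ℝ (Fin d))) →L[ℂ]
          Lp X q (volume : Measure (EuclideanSpace ℝ (Fin d))),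
        IsFourierExtensionEuclidean d T) ↔
      (∃ S : Lp X p (torusMeasure d) →L[ℂ]
          lp (fun _ : Fin d → ℤ => X) q,
        IsFourierExtensionTorus d S)) ∧
    ∀ (T : Lp X p (volume : Measure (EuclideanSpace ℝ (Fin d))) →L[ℂ]
          Lp X q (volume : Measure (EuclideanSpace ℝ (Fin d))))
      (S : Lp X p (torusMeasure d) →L[ℂ]
          lp (fun _ : Fin d → ℤ => X) q),
      IsFourierExtensionEuclidean d T → IsFourierExtensionTorus d S →
        ‖T‖ ≤ ‖S‖ ∧
        ‖S‖ ≤ π ^ d /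
            (2 * ((2 : ℝ) ^ q.toReal - 1) * (riemannZeta (q.toReal : ℂ)).re) ^
              ((d : ℝ) / q.toReal) * ‖T‖ ∧
        ‖S‖ ≤ (π / 2) ^ d * ‖T‖ := by
  have hp0 : p ≠ 0 := (zero_lt_one.trans hp1).ne'
  have hpt : p ≠ ∞ := ne_top_of_le_ne_top ENNReal.ofNat_ne_top hp2
  have hpq' : p.toReal.HolderConjugate q.toReal := by
    have h1 : 1 < p.toReal := by
      simpa using (ENNReal.toReal_lt_toReal ENNReal.one_ne_top hpt).2 hp1
    have hq0 : q ≠ 0 := (zero_lt_one.trans_le (Fact.out : 1 ≤ q)).ne'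
    refine Real.holderConjugate_iff.2 ⟨h1, ?_⟩
    have := congrArg ENNReal.toReal hpq
    rw [ENNReal.toReal_add (by simpa using hp0) (by simpa using hq0)] at this
    simpa using this
  refine ⟨⟨fun ⟨T, hT⟩ => exists_isFourierExtensionTorus hpq' hp2 hT,
    fun ⟨S, hS⟩ => exists_isFourierExtensionEuclidean hpq' hS⟩, fun T S hT hS => ?_⟩
  have h := norm_le_of_isFourierExtensionEuclidean hpq' hp2 hT hS
  refine ⟨norm_le_of_isFourierExtensionTorus hpq' hS hT, ?_, ?_⟩
  · rwa [← torusConstant_eq d hpq'.symm.lt]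
  · exact h.trans (by gcongr; exact torusConstant_le d hpq'.symm.lt)
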